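/- Let $L\ge 1$ and $\beta>0$. Let $\Gamma$ be the dual lattice of the periodic cubic lattice $\mathbb Z^3/L\mathbb Z^3$: its vertex set $\mathbb V_\Gamma=(\mathbb Z/L\mathbb Z)^3$ is the set of unit cubes, and its set $\mathbb E_\Gamma$ of (unoriented) edges $e=(v,i)$, $v\in\mathbb V_\Gamma$, $i\in\{1,2,3\}$, joining $v_1(e)=v$ to $v_2(e)=v+e_i$, is the set of plaquettes (the plaquette being the face shared by the two cubes). At each vertex $v$ of $\Gamma$ choose a pants decomposition of the sphere with six holes around $v$, the holes being the six plaquettes incident to $v$: combinatorially, four trinions with three boundary circles each, where each of the six holes is a boundary circle of exactly one trinion, and three additional circles each account for two of the remaining boundary circles, in such a way that the four trinions form a connected graph. Glueing these along plaquettes gives a trivalent trinion graph $\mathcal T$, whose edges are the $3L^3$ plaquettes and the $3L^3$ additional circles. Let $\mathcal P_{\mathcal T}$ be the set of $\mathbf t\in\mathbb R^{6L^3}$ (one coordinate for each edge of $\mathcal T$) such that for each trinion the coordinates $t_1,t_2,t_3$ of its three boundary circles satisfy the spherical triangle inequalities $0\le t_i\le 1$, $t_1+t_2+t_3\le 2$,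 $|t_2-t_3|\le t_1\le t_2+t_3$. The symplectic partition function with the Wilson action is $$Z_\beta=\int_{\mathcal P_{\mathcal T}}\exp\Big\{\frac{4}{\beta^2}\sum_{e\in\mathbb E_\Gamma}\cos \pi t_e\Big\}\,d\mathbf t ,$$ where $d\mathbf t$ is Lebesgue measure in all $6L^3$ coordinates. Write $\vec u_n(t)=\sqrt2\,\sin((n+1)\pi t)$, $\hat\chi_l(u)=\sin((l+1)u)/\sin u$ (the characters of $SU(2)$), $N_{p,k}=\binom{p}{p-k}-\binom{p}{p-k+1}$, and $\widetilde\sum_{l=a}^{b}$ for the sum over $l=a,a+2,a+4,\dots\le b$. Then: 1. The integral defining $Z_\beta$ converges. For all $p\ge0$ and all $u$ with $\sin u\neq0$, $\hat\chi_1(u)^p=\sum_{k=0}^{\lfloor p/2\rfloor}N_{p,k}\,\hat\chi_{p-2k}(u)$, that is, $N_{p,k}$ is the multiplicity of $\hat\chi_{p-2k}$ in the $p$-th power of the fundamental character; and $N_{p,k}>0$ for $2k\le p$. 2. For all $n,m\ge 0$, $$\int_0^1\vec u_n(t)\,\vec u_m(t)\,e^{\frac{4}{\beta^2}\cos\pi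 t}\,dt=\widetilde{\sum}_{l=|n-m|}^{n+m}\ \sum_{k=0}^\infty\frac{(2/\beta^2)^{l+2k}}{(l+2k)!}\,N_{l+2k,k},$$ the series over $k$ being convergent. 3. As (absolutely convergent) series over all labellings $n:\mathbb V_\Gamma\to\{0,1,2,\dots\}$, $$Z_\beta=\sum_{(n_v)}\ \prod_{v\in\mathbb V_\Gamma}\Big(\frac{\sqrt2}{\pi(n_v+1)}\Big)^4\prod_{e\in\mathbb E_\Gamma}\int_0^1\vec u_{n_{v_1(e)}}(t)\,\vec u_{n_{v_2(e)}}(t)\,e^{\frac{4}{\beta^2}\cos\pi t}\,dt$$ $$=\sum_{(n_v)}\ \prod_{v\in\mathbb V_\Gamma}\Big(\frac{\sqrt2}{\pi(n_v+1)}\Big)^4\prod_{e\in\mathbb E_\Gamma}\Big\{\widetilde{\sum}_{l_e=|n_{v_1(e)}-n_{v_2(e)}|}^{n_{v_1(e)}+n_{v_2(e)}}\ \sum_{k_e=0}^\infty\frac{(2/\beta^2)^{l_e+2k_e}}{(l_e+2k_e)!}\,N_{l_e+2k_e,k_e}\Big\},$$ and every term of the last series over $(n_v)$ is strictly positive. 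-/

import Mathlib

noncomputable section

namespace SymplecticLattice

/-- The dual lattice: its vertices are the unit cubes of the periodic cubic lattice of
period `L`, a copy of `(ℤ / L ℤ)³`. -/
abbrev DualVertex (L : ℕ) : Type := Fin 3 → ZMod L

/-- Unoriented edges of the dual lattice, i.e. plaquettes of the lattice. The pair `(v, i)` is
the edge that joins the cube `v` to the cube `v + e_i` (the face shared by these two cubes). -/
abbrev Plaquette (L : ℕ) : Type := DualVertex L × Fin 3

/-- The neighbour of `v` in the positive `i`-th direction. -/
def DualVertex.next {L : ℕ} (v : DualVertex L) (i : Fin 3) : DualVertex L := v + Pi.single i 1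

/-- The neighbour of `v` in the negative `i`-th direction. -/
def DualVertex.prev {L : ℕ} (v : DualVertex L) (i : Fin 3) : DualVertex L := v - Pi.single i 1

/-- The six faces of a cube: a direction, and `true` for the face in the positive sense of this
direction, `false` for the opposite one. -/
abbrev Face : Type := Fin 3 × Bool

/-- The plaquette which is the given face of the cube `v`. -/
def facePlaquette {L : ℕ} (v : DualVertex L) : Face → Plaquette L
  | (i, true) => (v, i)
  | (i, false) => (v.prev i, i)

/-- The combinatorial type of a pants decomposition of the sphere with six holes that surrounds a
vertex of the dual lattice: four trinions with three boundary circles each, every boundary circle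
being either one of the six holes (on exactly one trinion) or one of three further circles (each
shared by two sides of trinions), so that the trinions form a connected graph (hence a tree). -/
structure SixHolePants where
  side : Fin 4 → Fin 3 → Face ⊕ Fin 3
  hole_once : ∀ h : Face, ∃! p : Fin 4 × Fin 3, side p.1 p.2 = Sum.inl h
  inner_twice : ∀ c : Fin 3, {p : Fin 4 × Fin 3 | side p.1 p.2 = Sum.inr c}.ncard = 2
  connected : (SimpleGraph.fromRel fun a b : Fin 4 =>
    ∃ (j k : Fin 3) (c : Fin 3), side a j = Sum.inr c ∧ side b k = Sum.inr c).Connected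

/-- Edges of the trinion graph: the plaquettes, and three inner circles for each vertex of
the dual lattice. -/
abbrev TrinionEdge (L : ℕ) : Type := Plaquette L ⊕ (DualVertex L × Fin 3)

/-- The `j`-th edge of the trinion graph at the trinion `a` over the vertex `v`. -/
def trinionSide {L : ℕ} (D : DualVertex L → SixHolePants) (v : DualVertex L)
    (a : Fin 4) (j : Fin 3) : TrinionEdge L :=
  Sum.map (facePlaquette v) (fun c => (v, c)) ((D v).side a j)

/-- Spherical triangle inequalities. -/
def trinionPolytope : Set (Fin 3 → ℝ) :=
  {t | (∀ i, 0 ≤ t i ∧ t i ≤ 1) ∧ t 0 + t 1 + t 2 ≤ 2 ∧ |t 1 - t 2| ≤ t 0 ∧ t 0 ≤ t 1 + t 2}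

/-- The polytope of the trinion graph: the spherical triangle inequalities hold at each trinion. -/
def latticePolytope {L : ℕ} (D : DualVertex L → SixHolePants) : Set (TrinionEdge L → ℝ) :=
  {t | ∀ (v : DualVertex L) (a : Fin 4), (fun j => t (trinionSide D v a j)) ∈ trinionPolytope}

/-- The Wilson weight `exp ((4 / β ^ 2) * ∑ cos (π t_e))`, the sum being over the plaquettes. -/
def wilsonWeight (L : ℕ) [NeZero L] (β : ℝ) (t : TrinionEdge L → ℝ) : ℝ :=
  Real.exp (4 / β ^ 2 * ∑ e : Plaquette L, Real.cos (Real.pi * t (Sum.inl e)))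

/-- The symplectic partition function with the Wilson action: the integral of the Wilson weight
over the polytope of the trinion graph, with respect to Lebesgue measure in all the variables. -/
def partitionFunction {L : ℕ} [NeZero L] (D : DualVertex L → SixHolePants) (β : ℝ) : ℝ :=
  ∫ t in latticePolytope D, wilsonWeight L β t

/-- The orthonormal basis `√2 sin ((n + 1) π t)` of `L²([0,1])`. -/
def uVec (n : ℕ) (t : ℝ) : ℝ := Real.sqrt 2 * Real.sin ((n + 1) * Real.pi * t)

/-- The character of the irreducible representation of `SU(2)` of dimension `l + 1`, as a function
of the angle `u` such that the trace is `2 cos u`; it is used only where `sin u ≠ 0`. -/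
def su2Char (l : ℕ) (u : ℝ) : ℝ := Real.sin ((l + 1) * u) / Real.sin u

/-- The multiplicity of the character of index `p - 2 k` in the `p`-th power of the fundamental
character, for `2 k ≤ p`. -/
def charMult (p k : ℕ) : ℤ := (p.choose (p - k) : ℤ) - (p.choose (p - k + 1) : ℤ)

/-- The index set `a, a + 2, a + 4, …` up to `b`, of a sum which skips every alternate term. -/
def skipIcc (a b : ℕ) : Finset ℕ := (Finset.Icc a b).filter fun l => Even (l - a)

/-- The `k`-th term of the series with edge label `l`. -/
def edgeTerm (β : ℝ) (l k : ℕ) : ℝ :=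
  (2 / β ^ 2) ^ (l + 2 * k) / ((l + 2 * k).factorial : ℝ) * (charMult (l + 2 * k) k : ℝ)

/-- The contribution of an edge whose ends carry the labels `n` and `m`, as a series. -/
def edgeFactor (β : ℝ) (n m : ℕ) : ℝ :=
  ∑ l ∈ skipIcc (max n m - min n m) (n + m), ∑' k : ℕ, edgeTerm β l k

/-- The contribution of an edge whose ends carry the labels `n` and `m`, as an integral. -/
def edgeIntegral (β : ℝ) (n m : ℕ) : ℝ :=
  ∫ t in (0 : ℝ)..1, uVec n t * uVec m t * Real.exp (2 * (2 / β ^ 2) * Real.cos (Real.pi * t))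

/-- The term of the series over vertex labels `n`, for edge contributions given by `F`. -/
def vertexTerm {L : ℕ} [NeZero L] (F : ℕ → ℕ → ℝ) (n : DualVertex L → ℕ) : ℝ :=
  (∏ v : DualVertex L, (Real.sqrt 2 / (Real.pi * ((n v : ℝ) + 1))) ^ 4) *
    ∏ e : Plaquette L, F (n e.1) (n (e.1.next e.2))

end SymplecticLattice

end

/-! ### Powers of the fundamental character of SU(2), and the contribution of an edge. -/

noncomputable section

namespace SymplecticLattice

open Finset

/-! Write `c_n = √2 / (π (n + 1))` and `u_n = uVec n`. For `x, y` in `[0, 1]` the third side of a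
trinion ranges over the interval from `|x - y|` to `min (x + y) (2 - x - y)`, and its indicator has
sine coefficients `c_n u_n(x) u_n(y)` (`integral_sideRange_uVec`). The trinion indicator is thus
formally `∑ c_n u_n(x) u_n(y) u_n(s)`, and by orthonormality gluing along a circle multiplies
coefficients and removes the two factors of that circle.

Since `c_n` is not summable, this series is never used pointwise. The first gluing is a Parseval
identity, proved exactly from the cosine series of a Bernoulli polynomial (`hasSum_sideRange_mul`);
its series converges absolutely because `∑ c_n ^ 2` does. Further trinions are then attached by
termwise integration (`integral_sphereSeries_mul_trinionInd`). Connectedness supplies at each stage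
a circle leading to a new trinion, and after three gluings a vertex contributes `∑ c_n ^ 4 ∏
u_n(t_h)` over its six holes (`integral_prod_sideInd`).

Multiplying these series over all vertices gives an absolutely convergent series over labellings.
Each plaquette is a face of two cubes (counted with multiplicity), so integrating termwise leaves
one integral of `u_n u_m` against the weight per plaquette (`prod_faces`, `hasSum_vertexTerm`).

That integral is computed by the Clebsch-Gordan rule for `u_n u_m`, the Taylor series of the
exponential, and the Haar moments of characters, which are the multiplicities `charMult`
(`edgeIntegral_eq_edgeFactor`). All these terms are positive. -/

lemma charMult_zero_right (p : ℕ) : charMult p 0 = 1 := by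
  simp [charMult]

/-- The ratio of the second binomial coefficient to the first is `k / (p - k + 1)`, which is less
than one. -/
lemma charMult_pos {p k : ℕ} (h : 2 * k ≤ p) : 0 < charMult p k := by
  have h1 := Nat.choose_succ_right_eq p (p - k)
  have h2 : 0 < p.choose (p - k) := Nat.choose_pos (Nat.sub_le p k)
  have h3 : p - (p - k) = k := by omega
  rw [h3] at h1
  have h4 : p.choose (p - k + 1) < p.choose (p - k) := by
    by_contra! hle
    have := Nat.mul_le_mul_right (p - k + 1) hle
    have : p.choose (p - k) * (k + 1) ≤ p.choose (p - k) * (p - k + 1) :=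
      Nat.mul_le_mul_left _ (by omega)
    nlinarith
  unfold charMult
  have : (p.choose (p - k + 1) : ℤ) < p.choose (p - k) := by exact_mod_cast h4
  linarith

lemma charMult_succ_succ {p k : ℕ} (h : k + 1 ≤ p) :
    charMult (p + 1) (k + 1) = charMult p (k + 1) + charMult p k := by
  obtain ⟨q, rfl⟩ := Nat.exists_eq_add_of_le h
  unfold charMult
  have e1 : k + 1 + q + 1 - (k + 1) = q + 1 := by omega
  have e2 : k + 1 + q - (k + 1) = q := by omega
  have e3 : k + 1 + q - k = q + 1 := by omega
  rw [e1, e2, e3, Nat.choose_succ_succ, Nat.choose_succ_succ]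
  push_cast
  ring

/-- This zero just beyond the range `2 * k ≤ p` lets the sum for an odd power be extended by one
term. -/
lemma charMult_middle (r : ℕ) : charMult (2 * r + 1) (r + 1) = 0 := by
  unfold charMult
  have e1 : 2 * r + 1 - (r + 1) = r := by omega
  rw [e1, Nat.choose_symm_half, sub_self]

/-- The power of the fundamental character, times `sin u`, in terms of sines. -/
lemma two_cos_pow_mul_sin (p : ℕ) (u : ℝ) :
    (2 * Real.cos u) ^ p * Real.sin u =
      ∑ k ∈ range (p / 2 + 1), (charMult p k : ℝ) * Real.sin (((p - 2 * k : ℕ) + 1 : ℝ) * u) := by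
  have trig (m : ℝ) : 2 * Real.cos u * Real.sin (m * u) =
      Real.sin ((m + 1) * u) + Real.sin ((m - 1) * u) := by
    rw [add_mul, sub_mul, one_mul, Real.sin_add, Real.sin_sub]; ring
  have cast_sub (q k : ℕ) (hk : k ∈ range (q / 2 + 1)) :
      ((q - 2 * k : ℕ) : ℝ) = q - 2 * k := by
    have : 2 * k ≤ q := by have := mem_range.1 hk; omega
    push_cast [this]; ring
  have key (p r : ℕ) : 2 * Real.cos u *
      ∑ k ∈ range (r + 1), (charMult p k : ℝ) * Real.sin ((p - 2 * k + 1 : ℝ) * u) =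
      ∑ k ∈ range (r + 1), (charMult p k : ℝ) * Real.sin ((p - 2 * k + 2 : ℝ) * u) +
      ∑ k ∈ range (r + 1), (charMult p k : ℝ) * Real.sin ((p - 2 * k : ℝ) * u) := by
    rw [mul_sum, ← sum_add_distrib]
    refine sum_congr rfl fun k _ => ?_
    have := trig (p - 2 * k + 1)
    rw [show (p - 2 * k + 1 : ℝ) + 1 = p - 2 * k + 2 by ring,
      show (p - 2 * k + 1 : ℝ) - 1 = p - 2 * k by ring] at this
    linear_combination (charMult p k : ℝ) * this
  -- Pascal's rule merges the two shifted sums of `key`; the second one is delayed by one index,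
  -- hence the shorter range.
  have step (p r : ℕ) (hr : r ≤ p) :
      ∑ k ∈ range (r + 1), (charMult (p + 1) k : ℝ) * Real.sin (((p + 1 : ℕ) - 2 * k + 1 : ℝ) * u) =
      ∑ k ∈ range (r + 1), (charMult p k : ℝ) * Real.sin ((p - 2 * k + 2 : ℝ) * u) +
      ∑ k ∈ range r, (charMult p k : ℝ) * Real.sin ((p - 2 * k : ℝ) * u) := by
    rw [sum_range_succ', sum_range_succ' _ r, charMult_zero_right, charMult_zero_right,
      add_right_comm, ← sum_add_distrib]
    congr 1
    · refine sum_congr rfl fun k hk => ?_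
      rw [charMult_succ_succ (by have := mem_range.1 hk; omega)]
      push_cast
      ring_nf
    · push_cast; ring_nf
  -- The induction uses the real number `p - 2 * k` in place of truncated subtraction.
  suffices H : (2 * Real.cos u) ^ p * Real.sin u =
      ∑ k ∈ range (p / 2 + 1), (charMult p k : ℝ) * Real.sin ((p - 2 * k + 1 : ℝ) * u) by
    rw [H]
    refine sum_congr rfl fun k hk => ?_
    rw [cast_sub p k hk]
  induction p with
  | zero => simp [charMult]
  | succ p ih =>
    rw [pow_succ, mul_right_comm, ih, mul_comm, key]
    rcases Nat.even_or_odd' p with ⟨r, rfl | rfl⟩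
    -- For even `p` the surplus last term of the second sum is a multiple of `sin 0`.
    · rw [show (2 * r + 1) / 2 = r by omega, show 2 * r / 2 = r by omega, step _ _ (by omega),
        sum_range_succ (fun k : ℕ => (charMult (2 * r) k : ℝ) *
          Real.sin (((2 * r : ℕ) - 2 * k : ℝ) * u)) r]
      simp
    -- For odd `p` the missing last term of the first sum has coefficient zero.
    · rw [show (2 * r + 1 + 1) / 2 = r + 1 by omega, show (2 * r + 1) / 2 = r by omega,
        step _ _ (by omega), sum_range_succ _ (r + 1), charMult_middle]
      simp

lemma su2Char_one_pow (p : ℕ) {u : ℝ} (hu : Real.sin u ≠ 0) :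
    su2Char 1 u ^ p =
      ∑ k ∈ range (p / 2 + 1), (charMult p k : ℝ) * su2Char (p - 2 * k) u := by
  have h1 : su2Char 1 u = 2 * Real.cos u := by
    unfold su2Char
    rw [show ((1 : ℕ) + 1 : ℝ) * u = 2 * u by norm_num, Real.sin_two_mul]
    field_simp
  rw [h1, ← mul_left_inj' hu, two_cos_pow_mul_sin, sum_mul]
  refine sum_congr rfl fun k _ => ?_
  rw [su2Char, mul_assoc, div_mul_cancel₀ _ hu]

lemma integral_sin_mul_sin (a b : ℕ) :
    ∫ t in (0 : ℝ)..1, 2 * Real.sin ((a + 1) * (Real.pi * t)) * Real.sin ((b + 1) * (Real.pi * t)) =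
      if a = b then 1 else 0 := by
  have hcos (m : ℤ) : ∫ t in (0 : ℝ)..1, Real.cos (m * Real.pi * t) = if m = 0 then 1 else 0 := by
    split_ifs with h
    · simp [h]
    · have hm : (m * Real.pi : ℝ) ≠ 0 := mul_ne_zero (by exact_mod_cast h) Real.pi_ne_zero
      rw [intervalIntegral.integral_comp_mul_left (fun x => Real.cos x) hm]
      simp [Real.sin_int_mul_pi]
  have h1 (t : ℝ) : 2 * Real.sin ((a + 1) * (Real.pi * t)) * Real.sin ((b + 1) * (Real.pi * t)) =
      Real.cos (((a : ℤ) - b : ℤ) * Real.pi * t) -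
        Real.cos (((a : ℤ) + b + 2 : ℤ) * Real.pi * t) := by
    push_cast
    rw [show ((a : ℝ) - b) * Real.pi * t = (a + 1) * (Real.pi * t) - (b + 1) * (Real.pi * t) by ring,
      show ((a : ℝ) + b + 2) * Real.pi * t = (a + 1) * (Real.pi * t) + (b + 1) * (Real.pi * t) by
        ring, Real.cos_sub, Real.cos_add]
    ring
  simp_rw [h1]
  rw [intervalIntegral.integral_sub (by apply Continuous.intervalIntegrable; fun_prop)
    (by apply Continuous.intervalIntegrable; fun_prop), hcos, hcos]
  have : (a : ℤ) + b + 2 ≠ 0 := by omega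
  simp [this, sub_eq_zero]

/-- Moments of the characters for the Haar measure of `SU(2)`. -/
lemma integral_moment (p l : ℕ) :
    ∫ t in (0 : ℝ)..1, 2 * Real.sin ((l + 1) * (Real.pi * t)) *
        ((2 * Real.cos (Real.pi * t)) ^ p * Real.sin (Real.pi * t)) =
      ∑ k ∈ range (p / 2 + 1), (charMult p k : ℝ) * (if l = p - 2 * k then 1 else 0) := by
  simp_rw [two_cos_pow_mul_sin, mul_sum]
  rw [intervalIntegral.integral_finsetSum
    (fun i _ => by apply Continuous.intervalIntegrable; fun_prop)]
  refine sum_congr rfl fun k _ => ?_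
  rw [← integral_sin_mul_sin, ← intervalIntegral.integral_const_mul]
  congr 1
  ext t
  ring

lemma integral_moment_add (l k : ℕ) :
    ∫ t in (0 : ℝ)..1, 2 * Real.sin ((l + 1) * (Real.pi * t)) *
        ((2 * Real.cos (Real.pi * t)) ^ (l + 2 * k) * Real.sin (Real.pi * t)) =
      charMult (l + 2 * k) k := by
  rw [integral_moment, sum_eq_single k]
  · simp
  · intro j hj hjk
    have := mem_range.1 hj
    rw [if_neg (by omega), mul_zero]
  · intro h
    exact absurd (mem_range.2 (by omega)) h

lemma integral_moment_eq_zero {p l : ℕ} (h : ∀ k, p ≠ l + 2 * k) :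
    ∫ t in (0 : ℝ)..1, 2 * Real.sin ((l + 1) * (Real.pi * t)) *
        ((2 * Real.cos (Real.pi * t)) ^ p * Real.sin (Real.pi * t)) = 0 := by
  rw [integral_moment]
  refine sum_eq_zero fun k hk => ?_
  have := mem_range.1 hk
  rw [if_neg (by have := h k; omega), mul_zero]

/-- Taylor expansion of the exponential in powers of `2 cos`, integrated termwise by dominated
convergence. -/
lemma hasSum_moment (b : ℝ) (l : ℕ) :
    HasSum (fun p : ℕ => b ^ p / (p.factorial : ℝ) *
        ∫ t in (0 : ℝ)..1, 2 * Real.sin ((l + 1) * (Real.pi * t)) *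
          ((2 * Real.cos (Real.pi * t)) ^ p * Real.sin (Real.pi * t)))
      (∫ t in (0 : ℝ)..1, 2 * Real.sin ((l + 1) * (Real.pi * t)) * Real.sin (Real.pi * t) *
        Real.exp (2 * b * Real.cos (Real.pi * t))) := by
  have hs : Summable fun p : ℕ => 2 * ((2 * |b|) ^ p / (p.factorial : ℝ)) :=
    (Real.summable_pow_div_factorial _).mul_left 2
  have := intervalIntegral.hasSum_integral_of_dominated_convergence (a := 0) (b := 1)
    (μ := MeasureTheory.volume)
    (F := fun (p : ℕ) (t : ℝ) => b ^ p / (p.factorial : ℝ) *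
      (2 * Real.sin ((l + 1) * (Real.pi * t)) *
          ((2 * Real.cos (Real.pi * t)) ^ p * Real.sin (Real.pi * t))))
    (f := fun t => 2 * Real.sin ((l + 1) * (Real.pi * t)) * Real.sin (Real.pi * t) *
        Real.exp (2 * b * Real.cos (Real.pi * t)))
    (fun p _ => 2 * ((2 * |b|) ^ p / (p.factorial : ℝ)))
    (fun p => (by fun_prop : Continuous _).aestronglyMeasurable)
    (fun p => Filter.Eventually.of_forall fun t _ => ?_)
    (Filter.Eventually.of_forall fun t _ => hs) (by simp)
    (Filter.Eventually.of_forall fun t _ => ?_)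
  · simpa only [intervalIntegral.integral_const_mul] using this
  · rw [Real.norm_eq_abs]
    simp only [abs_mul, abs_div, abs_pow, Nat.abs_cast, abs_two]
    have h1 := Real.abs_sin_le_one ((l + 1) * (Real.pi * t))
    have h2 := Real.abs_sin_le_one (Real.pi * t)
    have h3 := Real.abs_cos_le_one (Real.pi * t)
    calc _ ≤ |b| ^ p / p.factorial * (2 * 1 * ((2 * 1) ^ p * 1)) := by gcongr
      _ = _ := by rw [mul_pow]; ring
  · have h := NormedSpace.expSeries_div_hasSum_exp (2 * b * Real.cos (Real.pi * t))
    rw [← Real.exp_eq_exp_ℝ] at h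
    refine (h.mul_left (2 * Real.sin ((l + 1) * (Real.pi * t)) * Real.sin (Real.pi * t))).congr_fun
      fun p => ?_
    rw [show 2 * b * Real.cos (Real.pi * t) = b * (2 * Real.cos (Real.pi * t)) by ring, mul_pow]
    ring

lemma hasSum_edgeTerm (β : ℝ) (l : ℕ) :
    HasSum (edgeTerm β l)
      (∫ t in (0 : ℝ)..1, 2 * Real.sin ((l + 1) * (Real.pi * t)) * Real.sin (Real.pi * t) *
        Real.exp (2 * (2 / β ^ 2) * Real.cos (Real.pi * t))) := by
  have h := hasSum_moment (2 / β ^ 2) l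
  -- Only the powers `l + 2 * k` contain the character of index `l`, so the series is reindexed by
  -- `k`.
  have hinj : Function.Injective fun k : ℕ => l + 2 * k := fun a b h => by
    simpa using h
  rw [← hinj.hasSum_iff] at h
  · refine h.congr_fun fun k => ?_
    rw [Function.comp_apply, integral_moment_add, edgeTerm]
  · intro p hp
    rw [integral_moment_eq_zero, mul_zero]
    exact fun k hk => hp ⟨k, hk.symm⟩

lemma skipIcc_succ (m d : ℕ) :
    skipIcc d (d + 2 * (m + 1)) = insert (d + 2 * (m + 1)) (skipIcc d (d + 2 * m)) := by
  ext l
  simp only [skipIcc, mem_filter, mem_Icc, mem_insert, Nat.even_iff]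
  omega

/-- The Clebsch-Gordan rule for characters, multiplied by `sin x ^ 2`. Raising `m` by one changes
the left side by exactly the new top term. -/
lemma sin_mul_sin_eq_sum (m d : ℕ) (x : ℝ) :
    Real.sin ((m + d + 1) * x) * Real.sin ((m + 1) * x) =
      ∑ l ∈ skipIcc d (d + 2 * m), Real.sin ((l + 1) * x) * Real.sin x := by
  have trig (a b : ℝ) : Real.sin a * Real.sin b = (Real.cos (a - b) - Real.cos (a + b)) / 2 := by
    rw [Real.cos_sub, Real.cos_add]; ring
  induction m with
  | zero => simp [skipIcc, filter_singleton]
  | succ m ih =>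
    rw [skipIcc_succ, sum_insert (by simp [skipIcc]), ← ih, trig, trig, trig]
    push_cast
    ring_nf

lemma uVec_mul_uVec (n m : ℕ) (t : ℝ) :
    uVec n t * uVec m t = ∑ l ∈ skipIcc (max n m - min n m) (n + m),
      2 * Real.sin ((l + 1) * (Real.pi * t)) * Real.sin (Real.pi * t) := by
  wlog h : m ≤ n generalizing n m
  · rw [mul_comm, this m n (le_of_not_ge h), max_comm, min_comm, add_comm]
  obtain ⟨d, rfl⟩ := Nat.exists_eq_add_of_le h
  have e1 : max (m + d) m - min (m + d) m = d := by omega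
  have e2 : m + d + m = d + 2 * m := by omega
  have h2 := sin_mul_sin_eq_sum m d (Real.pi * t)
  simp_rw [mul_assoc (2 : ℝ)]
  rw [e1, e2, ← mul_sum, ← h2, uVec, uVec, mul_mul_mul_comm, Real.mul_self_sqrt zero_le_two]
  push_cast
  ring_nf

lemma edgeIntegral_eq_edgeFactor (β : ℝ) (n m : ℕ) : edgeIntegral β n m = edgeFactor β n m := by
  unfold edgeIntegral edgeFactor
  simp_rw [uVec_mul_uVec, sum_mul]
  rw [intervalIntegral.integral_finsetSum
    (fun i _ => by apply Continuous.intervalIntegrable; fun_prop)]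
  exact sum_congr rfl fun l _ => (hasSum_edgeTerm β l).tsum_eq.symm

lemma edgeFactor_pos {β : ℝ} (hβ : 0 < β) (n m : ℕ) : 0 < edgeFactor β n m := by
  have hpos (l k : ℕ) : 0 < edgeTerm β l k := by
    have : (0 : ℝ) < charMult (l + 2 * k) k := by exact_mod_cast charMult_pos (by omega)
    unfold edgeTerm
    positivity
  refine sum_pos (fun l _ => ?_) ⟨max n m - min n m, ?_⟩
  · exact (hasSum_edgeTerm β l).summable.tsum_pos (fun k => (hpos l k).le) 0 (hpos l 0)
  · simp only [skipIcc, mem_filter, mem_Icc, le_refl, true_and, tsub_self, Even.zero, and_true]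
    omega

lemma vertexTerm_pos {L : ℕ} [NeZero L] {F : ℕ → ℕ → ℝ} (hF : ∀ n m, 0 < F n m)
    (n : DualVertex L → ℕ) : 0 < vertexTerm F n := by
  have := Real.pi_pos
  exact mul_pos (prod_pos fun v _ => by positivity) (prod_pos fun e _ => hF _ _)

end SymplecticLattice

end

/-! ### Sine coefficients of the trinion polytope, and Parseval's identity. -/

noncomputable section

namespace SymplecticLattice

open Finset MeasureTheory

lemma hasSum_of_eq {ι : Type*} {f g : ι → ℝ} {a b : ℝ} (h : HasSum f a) (hf : ∀ i, g i = f i)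
    (ha : b = a) : HasSum g b := by
  rw [funext hf, ha]
  exact h

/-- The coefficient of the expansion of the indicator of the trinion polytope. -/
def trinionCoeff (n : ℕ) : ℝ := Real.sqrt 2 / (Real.pi * ((n : ℝ) + 1))

/-- The range of a spherical side length, given the two other side lengths `x` and `y`. -/
def sideRange (x y : ℝ) : Set ℝ := Set.Icc |x - y| (min (x + y) (2 - x - y))

/-- The indicator function of the trinion polytope. -/
def trinionInd (t : Fin 3 → ℝ) : ℝ := trinionPolytope.indicator 1 t

lemma abs_sub_le_min {x y : ℝ} (hx : x ∈ Set.Icc (0 : ℝ) 1) (hy : y ∈ Set.Icc (0 : ℝ) 1) :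
    |x - y| ≤ min (x + y) (2 - x - y) := by
  obtain ⟨hx0, hx1⟩ := hx
  obtain ⟨hy0, hy1⟩ := hy
  rw [le_min_iff, abs_le, abs_le]
  refine ⟨⟨?_, ?_⟩, ?_, ?_⟩ <;> linarith

lemma min_le_one (x y : ℝ) : min (x + y) (2 - x - y) ≤ 1 := by
  rcases min_cases (x + y) (2 - x - y) with h | h <;> linarith

/-- The inequalities are symmetric in the three sides although written asymmetrically, so any side
may be the glued one. The indices `j + 1`, `j + 2` are cyclic in `Fin 3`. -/
lemma mem_trinionPolytope_iff {t : Fin 3 → ℝ} (j : Fin 3)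
    (h1 : t (j + 1) ∈ Set.Icc (0 : ℝ) 1) (h2 : t (j + 2) ∈ Set.Icc (0 : ℝ) 1) :
    t ∈ trinionPolytope ↔ t j ∈ sideRange (t (j + 1)) (t (j + 2)) := by
  have hm := min_le_one (t (j + 1)) (t (j + 2))
  obtain ⟨ha, hb⟩ := h1
  obtain ⟨hc, hd⟩ := h2
  simp only [trinionPolytope, sideRange, Set.mem_ofPred_eq, Set.mem_Icc, le_min_iff, abs_le,
    Fin.forall_fin_succ, Fin.forall_fin_zero] at *
  fin_cases j <;> simp at * <;> constructor <;> intro h <;> grind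

lemma trinionInd_eq {t : Fin 3 → ℝ} (j : Fin 3)
    (h1 : t (j + 1) ∈ Set.Icc (0 : ℝ) 1) (h2 : t (j + 2) ∈ Set.Icc (0 : ℝ) 1) :
    trinionInd t = (sideRange (t (j + 1)) (t (j + 2))).indicator 1 (t j) := by
  by_cases h : t ∈ trinionPolytope
  · rw [trinionInd, Set.indicator_of_mem h,
      Set.indicator_of_mem ((mem_trinionPolytope_iff j h1 h2).1 h)]
    rfl
  · rw [trinionInd, Set.indicator_of_notMem h,
      Set.indicator_of_notMem (mt (mem_trinionPolytope_iff j h1 h2).2 h)]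

lemma continuous_uVec (n : ℕ) : Continuous (uVec n) := by
  unfold uVec; fun_prop

lemma abs_uVec_le (n : ℕ) (t : ℝ) : |uVec n t| ≤ 2 := by
  have h := Real.abs_sin_le_one ((n + 1) * Real.pi * t)
  have h2 : √(2 : ℝ) ≤ 2 := by rw [Real.sqrt_le_left] <;> norm_num
  rw [uVec, abs_mul, abs_of_nonneg (Real.sqrt_nonneg 2)]
  calc _ ≤ 2 * (1 : ℝ) := by gcongr
    _ = 2 := by norm_num

/-- The reflection `s ↦ 2 - s` preserves these cosines; this removes the minimum from the endpoint
of `sideRange`. -/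
lemma cos_mul_min (n : ℕ) (s : ℝ) :
    Real.cos ((n + 1) * Real.pi * min s (2 - s)) = Real.cos ((n + 1) * Real.pi * s) := by
  rcases min_choice s (2 - s) with h | h <;> rw [h]
  rw [show (n + 1) * Real.pi * (2 - s) = (n + 1 : ℕ) * (2 * Real.pi) - (n + 1) * Real.pi * s by
    push_cast; ring, Real.cos_nat_mul_two_pi_sub]

lemma cos_mul_abs (a s : ℝ) : Real.cos (a * |s|) = Real.cos (a * s) := by
  rcases abs_choice s with h | h <;> rw [h]
  rw [mul_neg, Real.cos_neg]

lemma cos_sub_cos_eq (n : ℕ) (x y : ℝ) :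
    Real.cos ((n + 1) * Real.pi * |x - y|) -
      Real.cos ((n + 1) * Real.pi * min (x + y) (2 - x - y)) = uVec n x * uVec n y := by
  rw [show 2 - x - y = 2 - (x + y) by ring, cos_mul_min, cos_mul_abs, uVec, uVec, mul_sub, mul_add,
    Real.cos_sub, Real.cos_add, mul_mul_mul_comm, Real.mul_self_sqrt zero_le_two]
  ring

lemma sideRange_subset (x y : ℝ) : sideRange x y ⊆ Set.Icc 0 1 :=
  Set.Icc_subset_Icc (abs_nonneg _) (min_le_one x y)

lemma measurableSet_sideRange (x y : ℝ) : MeasurableSet (sideRange x y) := measurableSet_Icc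

lemma integral_sideRange_uVec (n : ℕ) {x y : ℝ} (hx : x ∈ Set.Icc (0 : ℝ) 1)
    (hy : y ∈ Set.Icc (0 : ℝ) 1) :
    ∫ s in Set.Icc (0 : ℝ) 1, (sideRange x y).indicator 1 s * uVec n s =
      trinionCoeff n * (uVec n x * uVec n y) := by
  have h1 : ∀ s, (sideRange x y).indicator 1 s * uVec n s = (sideRange x y).indicator (uVec n) s :=
    fun s => by by_cases h : s ∈ sideRange x y <;> simp [h]
  simp_rw [h1]
  rw [setIntegral_indicator (measurableSet_sideRange x y),
    Set.inter_eq_right.2 (sideRange_subset x y), sideRange, integral_Icc_eq_integral_Ioc,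
    ← intervalIntegral.integral_of_le (abs_sub_le_min hx hy), ← cos_sub_cos_eq]
  have hn : ((n : ℝ) + 1) * Real.pi ≠ 0 := by positivity
  simp only [uVec]
  rw [intervalIntegral.integral_const_mul,
    intervalIntegral.integral_comp_mul_left (fun x => Real.sin x) hn, integral_sin, trinionCoeff,
    smul_eq_mul]
  field_simp

/-- The cosine series of the second Bernoulli polynomial. -/
lemma hasSum_cos_div_sq {θ : ℝ} (h0 : 0 ≤ θ) (h2 : θ ≤ 2) :
    HasSum (fun n : ℕ => Real.cos ((n + 1) * Real.pi * θ) / (Real.pi * (n + 1)) ^ 2)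
      (θ ^ 2 / 4 - θ / 2 + 1 / 6) := by
  have h := hasSum_one_div_nat_pow_mul_cos (k := 1) one_ne_zero (x := θ / 2)
    ⟨by linarith, by linarith⟩
  -- The dropped term of index zero vanishes, since division by zero gives zero.
  rw [← hasSum_nat_add_iff' 1] at h
  have h' := h.div_const (Real.pi ^ 2)
  refine hasSum_of_eq h' (fun n => ?_) ?_
  · push_cast
    rw [show 2 * Real.pi * (n + 1) * (θ / 2) = (n + 1) * Real.pi * θ by ring]
    field_simp
  · simp [Polynomial.bernoulli_def, Finset.sum_range_succ, bernoulli_one, bernoulli_two,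
      Nat.factorial]
    field_simp
    ring

/-- The product formula for cosines turns the series into the Bernoulli series at `a + b` and at `|a
- b|`. -/
lemma hasSum_cos_mul_cos {a b : ℝ} (ha : a ∈ Set.Icc (0 : ℝ) 1) (hb : b ∈ Set.Icc (0 : ℝ) 1) :
    HasSum (fun n : ℕ => trinionCoeff n ^ 2 *
        (Real.cos ((n + 1) * Real.pi * a) * Real.cos ((n + 1) * Real.pi * b)))
      ((a ^ 2 + b ^ 2) / 2 - max a b + 1 / 3) := by
  obtain ⟨ha0, ha1⟩ := ha
  obtain ⟨hb0, hb1⟩ := hb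
  have h1 := hasSum_cos_div_sq (θ := a + b) (by linarith) (by linarith)
  have h2 := hasSum_cos_div_sq (θ := |a - b|) (abs_nonneg _)
    (by rw [abs_le]; constructor <;> linarith)
  refine hasSum_of_eq (h1.add h2) (fun n => ?_) ?_
  · rw [cos_mul_abs, mul_add _ a b, mul_sub _ a b, Real.cos_add, Real.cos_sub, trinionCoeff,
      div_pow, Real.sq_sqrt zero_le_two]
    ring
  · rw [sq_abs]
    rcases le_total a b with h | h
    · rw [max_eq_right h, abs_of_nonpos (by linarith)]; ring
    · rw [max_eq_left h, abs_of_nonneg (by linarith)]; ring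

/-- Parseval's identity for the indicators of two admissible ranges. -/
lemma hasSum_sideRange_mul {x y x' y' : ℝ} (hx : x ∈ Set.Icc (0 : ℝ) 1)
    (hy : y ∈ Set.Icc (0 : ℝ) 1) (hx' : x' ∈ Set.Icc (0 : ℝ) 1) (hy' : y' ∈ Set.Icc (0 : ℝ) 1) :
    HasSum (fun n => trinionCoeff n ^ 2 * ((uVec n x * uVec n y) * (uVec n x' * uVec n y')))
      (∫ s in Set.Icc (0 : ℝ) 1, (sideRange x y).indicator 1 s *
        (sideRange x' y').indicator 1 s) := by
  have hle := abs_sub_le_min hx hy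
  have hle' := abs_sub_le_min hx' hy'
  have h1 := min_le_one x y
  have h1' := min_le_one x' y'
  have h0 := abs_nonneg (x - y)
  have h0' := abs_nonneg (x' - y')
  have hind : ∀ s, (sideRange x y).indicator (1 : ℝ → ℝ) s * (sideRange x' y').indicator 1 s =
      (sideRange x y ∩ sideRange x' y').indicator 1 s := fun s => by
    rw [Set.inter_indicator_one]; rfl
  simp_rw [hind, ← cos_sub_cos_eq]
  rw [setIntegral_indicator ((measurableSet_sideRange x y).inter (measurableSet_sideRange x' y')),
    Set.inter_eq_right.2 (Set.inter_subset_left.trans (sideRange_subset x y))]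
  simp only [Pi.one_apply, sideRange]
  -- From here on only two intervals in `[0, 1]` matter, with endpoints `a ≤ b` and `a' ≤ b'`.
  generalize |x - y| = a at *
  generalize |x' - y'| = a' at *
  generalize min (x + y) (2 - x - y) = b at *
  generalize min (x' + y') (2 - x' - y') = b' at *
  have mem {r : ℝ} (h0 : 0 ≤ r) (h1 : r ≤ 1) : r ∈ Set.Icc (0 : ℝ) 1 := ⟨h0, h1⟩
  have ha := mem h0 (hle.trans h1)
  have ha' := mem h0' (hle'.trans h1')
  have hb := mem (h0.trans hle) h1
  have hb' := mem (h0'.trans hle') h1'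
  refine hasSum_of_eq (((hasSum_cos_mul_cos ha ha').sub (hasSum_cos_mul_cos ha hb')).sub
    ((hasSum_cos_mul_cos hb ha').sub (hasSum_cos_mul_cos hb hb'))) (fun n => ?_) ?_
  · ring
  -- In the mixed difference over endpoints the squares and constants cancel; the four maxima left
  -- combine to the length of the intersection.
  · rw [Set.Icc_inter_Icc, setIntegral_const, smul_eq_mul, mul_one, measureReal_def,
      Real.volume_Icc, ENNReal.toReal_ofReal']
    grind

lemma summable_trinionCoeff_pow {k : ℕ} (hk : 2 ≤ k) :
    Summable fun n => trinionCoeff n ^ k := by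
  have h : Summable fun n : ℕ => 1 / ((n + 1 : ℕ) : ℝ) ^ k :=
    (summable_nat_add_iff 1).2 (Real.summable_one_div_nat_pow.2 (by omega))
  refine (h.mul_left ((√2 / Real.pi) ^ k)).congr fun n => ?_
  rw [trinionCoeff, ← div_div, div_pow (√2 / Real.pi)]
  push_cast
  ring

lemma trinionCoeff_nonneg (n : ℕ) : 0 ≤ trinionCoeff n := by
  have := Real.pi_pos
  unfold trinionCoeff
  positivity

lemma trinionInd_nonneg (t : Fin 3 → ℝ) : 0 ≤ trinionInd t :=
  Set.indicator_nonneg (fun _ _ => zero_le_one) t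

lemma trinionInd_le_one (t : Fin 3 → ℝ) : trinionInd t ≤ 1 :=
  Set.indicator_le_self' (fun _ _ => zero_le_one) t

lemma measurableSet_trinionPolytope : MeasurableSet trinionPolytope := by
  refine IsClosed.measurableSet ?_
  simp only [trinionPolytope, Set.ofPred_and, Set.ofPred_forall]
  refine IsClosed.inter (isClosed_iInter fun i => IsClosed.inter ?_ ?_)
    (IsClosed.inter ?_ (IsClosed.inter ?_ ?_)) <;> exact isClosed_le (by fun_prop) (by fun_prop)

lemma measurable_trinionInd : Measurable trinionInd :=
  measurable_one.indicator measurableSet_trinionPolytope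

end SymplecticLattice

end

/-! ### Averaging over one coordinate, and gluing along one circle. -/

noncomputable section

namespace SymplecticLattice

open Finset MeasureTheory

/-- Lebesgue measure on the unit interval. -/
def unitMeasure : Measure ℝ := volume.restrict (Set.Icc 0 1)

instance : IsProbabilityMeasure unitMeasure := ⟨by simp [unitMeasure]⟩

/-- Lebesgue measure on the unit cube with coordinates labelled by `E`. -/
def cubeMeasure (E : Type*) [Fintype E] : Measure (E → ℝ) := Measure.pi fun _ => unitMeasure

instance (E : Type*) [Fintype E] : IsProbabilityMeasure (cubeMeasure E) := by
  unfold cubeMeasure; infer_instance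

lemma cubeMeasure_eq_restrict (E : Type*) [Fintype E] :
    cubeMeasure E = volume.restrict (Set.univ.pi fun _ : E => Set.Icc (0 : ℝ) 1) :=
  (Measure.restrict_pi_pi (fun _ : E => (volume : Measure ℝ)) fun _ => Set.Icc (0 : ℝ) 1).symm

lemma ae_mem_cube (E : Type*) [Fintype E] :
    ∀ᵐ t ∂cubeMeasure E, ∀ e, t e ∈ Set.Icc (0 : ℝ) 1 := by
  rw [cubeMeasure_eq_restrict]
  filter_upwards [ae_restrict_mem (MeasurableSet.univ_pi fun _ => measurableSet_Icc)] with t ht e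
  exact ht e trivial

section Averaging

variable {E : Type*} [Fintype E] [DecidableEq E]

/-- Resampling one coordinate of a product of probability measures does not change the law. This
allows integration over a single circle while every function keeps the same domain `E → ℝ`. -/
lemma measurePreserving_update (z : E) :
    MeasurePreserving (fun x : (E → ℝ) × ℝ => Function.update x.1 z x.2)
      ((cubeMeasure E).prod unitMeasure) (cubeMeasure E) := by
  have hm : Measurable fun x : (E → ℝ) × ℝ => Function.update x.1 z x.2 := by
    refine measurable_pi_lambda _ fun e => ?_
    by_cases h : e = z
    · subst h; simpa using measurable_snd
    · simp only [Function.update_of_ne h]; fun_prop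
  refine ⟨hm, ?_⟩
  unfold cubeMeasure
  refine (Measure.pi_eq fun s hs => ?_).symm
  have hpre : (fun x : (E → ℝ) × ℝ => Function.update x.1 z x.2) ⁻¹' Set.univ.pi s =
      (Set.univ.pi (Function.update s z Set.univ)) ×ˢ s z := by
    ext x
    simp only [Set.mem_preimage, Set.mem_pi, Set.mem_univ, forall_true_left, Set.mem_prod]
    constructor
    · refine fun h => ⟨fun e => ?_, by simpa using h z⟩
      by_cases he : e = z
      · subst he; simp
      · simpa [he] using h e
    · rintro ⟨h1, h2⟩ e
      by_cases he : e = z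
      · subst he; simpa using h2
      · simpa [he] using h1 e
  rw [Measure.map_apply hm (MeasurableSet.univ_pi hs), hpre, Measure.prod_prod, Measure.pi_pi,
    ← mul_prod_erase univ _ (mem_univ z), ← mul_prod_erase univ _ (mem_univ z)]
  simp only [Function.update_self, measure_univ, one_mul]
  rw [mul_comm]
  congr 1
  refine prod_congr rfl fun e he => ?_
  rw [Function.update_of_ne (ne_of_mem_erase he)]

/-- Averaging over one coordinate does not change the integral over the cube. -/
lemma integral_update (z : E) {F : (E → ℝ) → ℝ} (hF : Integrable F (cubeMeasure E)) :
    ∫ t, F t ∂cubeMeasure E =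
      ∫ t, ∫ s, F (Function.update t z s) ∂unitMeasure ∂cubeMeasure E := by
  have h := measurePreserving_update (E := E) z
  have hint := (h.integrable_comp hF.aestronglyMeasurable).2 hF
  rw [← h.map_eq] at hF
  conv_lhs => rw [← h.map_eq]
  rw [integral_map h.measurable.aemeasurable hF.aestronglyMeasurable]
  exact integral_prod _ hint

end Averaging

/-- Bounded measurable functions. -/
def BddMeas {X : Type*} [MeasurableSpace X] (F : X → ℝ) : Prop :=
  Measurable F ∧ ∃ B, ∀ x, |F x| ≤ B

namespace BddMeas

variable {X : Type*} [MeasurableSpace X] {F G : X → ℝ}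

lemma integrable (hF : BddMeas F) (μ : Measure X) [IsFiniteMeasure μ] : Integrable F μ := by
  obtain ⟨hm, B, hB⟩ := hF
  exact Integrable.of_bound hm.aestronglyMeasurable B (Filter.Eventually.of_forall hB)

lemma mul (hF : BddMeas F) (hG : BddMeas G) : BddMeas fun x => F x * G x := by
  obtain ⟨hm, B, hB⟩ := hF
  obtain ⟨hm', B', hB'⟩ := hG
  refine ⟨hm.mul hm', B * B', fun x => ?_⟩
  rw [abs_mul]
  exact mul_le_mul (hB x) (hB' x) (abs_nonneg _) ((abs_nonneg _).trans (hB x))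

lemma const (c : ℝ) : BddMeas fun _ : X => c := ⟨measurable_const, |c|, fun _ => le_rfl⟩

lemma prod {ι : Type*} (s : Finset ι) {F : ι → X → ℝ} (hF : ∀ i ∈ s, BddMeas (F i)) :
    BddMeas fun x => ∏ i ∈ s, F i x := by
  classical
  induction s using Finset.induction_on with
  | empty => simpa using const 1
  | insert a s ha ih =>
    simp_rw [prod_insert ha]
    exact (hF a (mem_insert_self a s)).mul (ih fun i hi => hF i (mem_insert_of_mem hi))

lemma comp {Y : Type*} [MeasurableSpace Y] (hF : BddMeas F) {g : Y → X} (hg : Measurable g) :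
    BddMeas fun y => F (g y) :=
  ⟨hF.1.comp hg, hF.2.imp fun _ h y => h (g y)⟩

end BddMeas

lemma bddMeas_trinionInd : BddMeas trinionInd :=
  ⟨measurable_trinionInd, 1, fun t => by
    rw [abs_of_nonneg (trinionInd_nonneg t)]; exact trinionInd_le_one t⟩

section Gluing

variable {E ι : Type*}

lemma abs_prod_uVec_le (Q : Finset ι) (f : ι → ℝ) (n : ℕ) :
    |∏ p ∈ Q, uVec n (f p)| ≤ 2 ^ Q.card := by
  rw [abs_prod, ← prod_const]
  exact prod_le_prod (fun _ _ => abs_nonneg _) fun p _ => abs_uVec_le n (f p)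

/-- The series associated with a sphere with holes `Q`, which has been glued from `k` trinions. -/
def sphereSeries (k : ℕ) (Q : Finset ι) (t : ι → ℝ) : ℝ :=
  ∑' n, trinionCoeff n ^ k * ∏ p ∈ Q, uVec n (t p)

lemma norm_sphereSeries_term_le (k : ℕ) (Q : Finset ι) (t : ι → ℝ) (n : ℕ) :
    ‖trinionCoeff n ^ k * ∏ p ∈ Q, uVec n (t p)‖ ≤ trinionCoeff n ^ k * 2 ^ Q.card := by
  have h := trinionCoeff_nonneg n
  rw [Real.norm_eq_abs, abs_mul, abs_of_nonneg (by positivity : 0 ≤ trinionCoeff n ^ k)]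
  gcongr
  exact abs_prod_uVec_le Q t n

lemma summable_sphereSeries {k : ℕ} (hk : 2 ≤ k) (Q : Finset ι) (t : ι → ℝ) :
    Summable fun n => trinionCoeff n ^ k * ∏ p ∈ Q, uVec n (t p) :=
  Summable.of_norm_bounded ((summable_trinionCoeff_pow hk).mul_right _)
    (norm_sphereSeries_term_le k Q t)

lemma continuous_sphereSeries {k : ℕ} (hk : 2 ≤ k) (Q : Finset ι) :
    Continuous (sphereSeries k Q) := by
  refine continuous_tsum (fun n => ?_) ((summable_trinionCoeff_pow hk).mul_right (2 ^ Q.card))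
    fun n t => norm_sphereSeries_term_le k Q t n
  exact continuous_const.mul (continuous_finsetProd _ fun p _ =>
    (continuous_uVec n).comp (continuous_apply p))

lemma bddMeas_sphereSeries [Countable ι] {k : ℕ} (hk : 2 ≤ k) (Q : Finset ι) :
    BddMeas (sphereSeries k Q) :=
  ⟨(continuous_sphereSeries hk Q).measurable, _, fun t =>
    tsum_of_norm_bounded ((summable_trinionCoeff_pow hk).mul_right _).hasSum
      (norm_sphereSeries_term_le k Q t)⟩

variable [DecidableEq E]

lemma prod_erase_fin_three (j : Fin 3) (g : Fin 3 → ℝ) :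
    ∏ i ∈ univ.erase j, g i = g (j + 1) * g (j + 2) := by
  fin_cases j
  · rw [show univ.erase (⟨0, by omega⟩ : Fin 3) = {1, 2} by decide, prod_pair (by decide)]; rfl
  · rw [show univ.erase (⟨1, by omega⟩ : Fin 3) = {2, 0} by decide, prod_pair (by decide)]; rfl
  · rw [show univ.erase (⟨2, by omega⟩ : Fin 3) = {0, 1} by decide, prod_pair (by decide)]; rfl

lemma trinionInd_update {t : E → ℝ} (ht : ∀ e, t e ∈ Set.Icc (0 : ℝ) 1) {a : Fin 3 → E} {z : E}
    {j : Fin 3} (hj : a j = z) (hne : ∀ i ≠ j, a i ≠ z) (s : ℝ) :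
    trinionInd (fun i => Function.update t z s (a i)) =
      (sideRange (t (a (j + 1))) (t (a (j + 2)))).indicator 1 s := by
  have h1 : a (j + 1) ≠ z := hne _ (by simp)
  have h2 : a (j + 2) ≠ z := hne _ (by simp)
  rw [trinionInd_eq j] <;> simp only [hj, Function.update_self, Function.update_of_ne h1,
    Function.update_of_ne h2, ht]

/-- Glueing two trinions along a circle. -/
lemma integral_trinionInd_mul {t : E → ℝ} (ht : ∀ e, t e ∈ Set.Icc (0 : ℝ) 1) {z : E}
    {a b : Fin 3 → E} {i j : Fin 3} (hi : a i = z) (hai : ∀ k ≠ i, a k ≠ z)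
    (hj : b j = z) (hbj : ∀ k ≠ j, b k ≠ z) :
    ∫ s, trinionInd (fun k => Function.update t z s (a k)) *
        trinionInd (fun k => Function.update t z s (b k)) ∂unitMeasure =
      ∑' n, trinionCoeff n ^ 2 * ((∏ k ∈ univ.erase i, uVec n (t (a k))) *
        ∏ k ∈ univ.erase j, uVec n (t (b k))) := by
  simp_rw [trinionInd_update ht hi hai, trinionInd_update ht hj hbj, prod_erase_fin_three]
  exact (hasSum_sideRange_mul (ht _) (ht _) (ht _) (ht _)).tsum_eq.symm

/-- Glueing a trinion to a sphere with holes along a circle. -/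
lemma integral_sphereSeries_mul_trinionInd [DecidableEq ι] {t : E → ℝ}
    (ht : ∀ e, t e ∈ Set.Icc (0 : ℝ) 1) {z : E} {k : ℕ} (hk : 2 ≤ k) {Q : Finset ι} {f : ι → E}
    {p : ι} (hp : p ∈ Q) (hpz : f p = z) (hQ : ∀ q ∈ Q, q ≠ p → f q ≠ z)
    {b : Fin 3 → E} {j : Fin 3} (hj : b j = z) (hbj : ∀ k ≠ j, b k ≠ z) :
    ∫ s, sphereSeries k Q (fun q => Function.update t z s (f q)) *
        trinionInd (fun k => Function.update t z s (b k)) ∂unitMeasure =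
      ∑' n, trinionCoeff n ^ (k + 1) * ((∏ q ∈ Q.erase p, uVec n (t (f q))) *
        ∏ k ∈ univ.erase j, uVec n (t (b k))) := by
  set R := sideRange (t (b (j + 1))) (t (b (j + 2))) with hR
  set w : ℕ → ℝ := fun n => ∏ q ∈ Q.erase p, uVec n (t (f q)) with hw
  have hprod (n : ℕ) (s : ℝ) : ∏ q ∈ Q, uVec n (Function.update t z s (f q)) =
      uVec n s * w n := by
    rw [← mul_prod_erase Q _ hp, hpz, Function.update_self]
    congr 1
    refine prod_congr rfl fun q hq => ?_
    rw [Function.update_of_ne (hQ q (mem_of_mem_erase hq) (ne_of_mem_erase hq))]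
  have hind (s : ℝ) : |R.indicator (1 : ℝ → ℝ) s| ≤ 1 := by
    by_cases h : s ∈ R <;> simp [h]
  have hmeas : Measurable (R.indicator (1 : ℝ → ℝ)) :=
    measurable_one.indicator (measurableSet_sideRange _ _)
  have hterm (n : ℕ) (s : ℝ) : ‖trinionCoeff n ^ k * (uVec n s * w n) * R.indicator 1 s‖ ≤
      trinionCoeff n ^ k * 2 ^ Q.card := by
    rw [norm_mul, ← hprod]
    exact (mul_le_of_le_one_right (norm_nonneg _) (hind s)).trans
      (norm_sphereSeries_term_le k Q (fun q => Function.update t z s (f q)) n)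
  have hint (n : ℕ) : Integrable (fun s => trinionCoeff n ^ k * (uVec n s * w n) *
      R.indicator 1 s) unitMeasure := by
    refine BddMeas.integrable ⟨?_, _, hterm n⟩ _
    have := (continuous_uVec n).measurable
    fun_prop
  simp_rw [trinionInd_update ht hj hbj, sphereSeries, hprod, ← hR, ← tsum_mul_right]
  -- Sum and integral commute because `2 ≤ k` makes `trinionCoeff n ^ k` summable; each term then
  -- gains one more factor `trinionCoeff n`.
  rw [← integral_tsum_of_summable_integral_norm hint]
  · refine tsum_congr fun n => ?_
    have h := integral_sideRange_uVec n (ht (b (j + 1))) (ht (b (j + 2)))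
    rw [← hR] at h
    rw [prod_erase_fin_three j (fun i => uVec n (t (b i))), pow_succ, mul_assoc,
      show trinionCoeff n * (w n * (uVec n (t (b (j + 1))) * uVec n (t (b (j + 2))))) =
        w n * (trinionCoeff n * (uVec n (t (b (j + 1))) * uVec n (t (b (j + 2))))) by ring,
      ← h, ← mul_assoc, ← integral_const_mul]
    refine integral_congr_ae (Filter.Eventually.of_forall fun s => ?_)
    ring
  · refine Summable.of_nonneg_of_le (fun n => integral_nonneg fun s => norm_nonneg _) (fun n => ?_)
      ((summable_trinionCoeff_pow hk).mul_right (2 ^ Q.card))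
    calc _ ≤ ∫ s, trinionCoeff n ^ k * 2 ^ Q.card ∂unitMeasure :=
          integral_mono (hint n).norm (integrable_const _) (hterm n)
      _ = _ := by simp

end Gluing

end SymplecticLattice

end

/-! ### Integrating out the inner circles over a vertex. -/

noncomputable section

namespace SymplecticLattice

open Finset MeasureTheory

namespace SixHolePants

/-- The sides on trinions of `S` which are not on a circle of `C`. -/
def openSides (P : SixHolePants) (S : Finset (Fin 4)) (C : Finset (Fin 3)) :
    Finset (Fin 4 × Fin 3) :=
  univ.filter fun p => p.1 ∈ S ∧ ∀ c ∈ C, P.side p.1 p.2 ≠ Sum.inr c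

/-- The trinion `a ∉ S` is joined to a trinion of `S` by the circle `c`, which is the side `j` of
`a` and the side `p` of the other trinion. -/
structure Joins (P : SixHolePants) (S : Finset (Fin 4)) (a : Fin 4) (j : Fin 3)
    (p : Fin 4 × Fin 3) (c : Fin 3) : Prop where
  notMem : a ∉ S
  mem : p.1 ∈ S
  side_new : P.side a j = Sum.inr c
  side_old : P.side p.1 p.2 = Sum.inr c
  eq_or : ∀ q : Fin 4 × Fin 3, P.side q.1 q.2 = Sum.inr c → q = p ∨ q = (a, j)

/-- A path from `S` to its complement crosses the boundary along some circle. As a circle has only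
two sides, the two found there are all of them. -/
lemma exists_joins (P : SixHolePants) {S : Finset (Fin 4)} (hS : S.Nonempty) (hS' : S ≠ univ) :
    ∃ a j p c, P.Joins S a j p c := by
  obtain ⟨x, hx⟩ := hS
  obtain ⟨y, hy⟩ : ∃ y, y ∉ S := by
    by_contra! h
    exact hS' (eq_univ_iff_forall.2 h)
  obtain ⟨w⟩ := P.connected.preconnected x y
  obtain ⟨d, -, hd1, hd2⟩ := w.exists_boundary_dart (S : Set (Fin 4)) (by simpa using hx)
    (by simpa using hy)
  have hadj := d.adj
  rw [SimpleGraph.fromRel_adj] at hadj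
  obtain ⟨i, j, c, hi, hj⟩ : ∃ (i j : Fin 3) (c : Fin 3),
      P.side d.fst i = Sum.inr c ∧ P.side d.snd j = Sum.inr c := by
    rcases hadj.2 with h | ⟨i, j, c, h1, h2⟩
    · exact h
    · exact ⟨j, i, c, h2, h1⟩
  refine ⟨d.snd, j, (d.fst, i), c, by simpa using hd2, by simpa using hd1, hj, hi, fun q hq => ?_⟩
  have hne : ((d.fst, i) : Fin 4 × Fin 3) ≠ (d.snd, j) := fun h => hadj.1 (Prod.ext_iff.1 h).1
  have hsub : ({(d.fst, i), (d.snd, j)} : Set (Fin 4 × Fin 3)) ⊆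
      {p | P.side p.1 p.2 = Sum.inr c} := by
    rintro r (rfl | rfl)
    · exact hi
    · exact hj
  have heq := Set.eq_of_subset_of_ncard_le hsub
    (by rw [P.inner_twice, Set.ncard_pair hne])
  have : q ∈ ({(d.fst, i), (d.snd, j)} : Set (Fin 4 × Fin 3)) := by rw [heq]; exact hq
  simpa using this

/-- Gluing along `c` closes the side `p` of the sphere and the side `j` of the trinion. By `hC` no
other side of the new trinion lies on a circle already used. -/
lemma prod_openSides_insert (P : SixHolePants) {S : Finset (Fin 4)} {C : Finset (Fin 3)}
    {a : Fin 4} {j : Fin 3} {p : Fin 4 × Fin 3} {c : Fin 3} (h : P.Joins S a j p c)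
    (hC : ∀ c ∈ C, ∀ q : Fin 4 × Fin 3, P.side q.1 q.2 = Sum.inr c → q.1 ∈ S)
    (g : Fin 4 × Fin 3 → ℝ) :
    ∏ q ∈ P.openSides (insert a S) (insert c C), g q =
      (∏ q ∈ (P.openSides S C).erase p, g q) * ∏ k ∈ univ.erase j, g (a, k) := by
  have hdisj : Disjoint ((P.openSides S C).erase p) ((univ.erase j).image fun k => (a, k)) := by
    rw [disjoint_left]
    intro q hq hq'
    obtain ⟨k, -, rfl⟩ := mem_image.1 hq'
    exact h.notMem (mem_filter.1 (mem_of_mem_erase hq)).2.1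
  have hunion : P.openSides (insert a S) (insert c C) =
      (P.openSides S C).erase p ∪ (univ.erase j).image fun k => (a, k) := by
    ext ⟨b, k⟩
    simp only [openSides, mem_filter, mem_univ, true_and, mem_union, mem_erase, mem_image,
      mem_insert, forall_eq_or_imp, and_true, Prod.mk.injEq]
    constructor
    · rintro ⟨rfl | hb, hc, hCk⟩
      · exact Or.inr ⟨k, fun hk => hc (hk ▸ h.side_new), rfl, rfl⟩
      · exact Or.inl ⟨fun hbk => hc (by rw [← h.side_old, ← hbk]), hb, hCk⟩
    · rintro (⟨hp, hb, hCk⟩ | ⟨k', hk, rfl, rfl⟩)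
      · refine ⟨Or.inr hb, fun hc => ?_, hCk⟩
        rcases h.eq_or (b, k) hc with h1 | h1
        · exact hp h1
        · obtain rfl : b = a := (Prod.ext_iff.1 h1).1
          exact h.notMem hb
      · refine ⟨Or.inl rfl, fun hc => ?_, fun c' hc' hs => h.notMem (hC c' hc' (_, _) hs)⟩
        rcases h.eq_or (a, k') hc with h1 | h1
        · exact h.notMem (by have := h.mem; rwa [← h1] at this)
        · exact hk (Prod.ext_iff.1 h1).2
  rw [hunion, prod_union hdisj, prod_image fun k _ k' _ hkk => (Prod.ext_iff.1 hkk).2]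

lemma prod_openSides_univ (P : SixHolePants) (g : Face → ℝ) (g' : Fin 3 → ℝ) :
    ∏ q ∈ P.openSides univ univ, Sum.elim g g' (P.side q.1 q.2) = ∏ h : Face, g h := by
  choose f hf huniq using P.hole_once
  symm
  refine prod_bij (fun h _ => f h) (fun h _ => ?_) (fun h _ h' _ hh => ?_) (fun q hq => ?_)
    (fun h _ => ?_)
  · simp [openSides, hf]
  · have := hf h
    rw [hh, hf h'] at this
    exact (Sum.inl_injective this).symm
  · rcases hs : P.side q.1 q.2 with h | c
    · exact ⟨h, mem_univ h, (huniq h q hs).symm⟩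
    · exact absurd hs ((mem_filter.1 hq).2.2 c (mem_univ c))
  · simp [hf]

end SixHolePants

variable {L : ℕ} [NeZero L] (D : DualVertex L → SixHolePants) (v : DualVertex L)

/-- The indicator of the spherical triangle inequalities at one trinion of the trinion graph. -/
def sideInd (a : Fin 4) (t : TrinionEdge L → ℝ) : ℝ := trinionInd fun j => t (trinionSide D v a j)

lemma bddMeas_sideInd (a : Fin 4) : BddMeas (sideInd D v a) :=
  bddMeas_trinionInd.comp (measurable_pi_lambda _ fun _ => measurable_pi_apply _)

lemma trinionSide_eq_inr_iff {a : Fin 4} {j c : Fin 3} :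
    trinionSide D v a j = Sum.inr (v, c) ↔ (D v).side a j = Sum.inr c := by
  unfold trinionSide
  rcases (D v).side a j with h | c' <;> simp

/-- A function on the trinion space that does not depend on the inner circles over `v`. -/
def IndepInner (R : (TrinionEdge L → ℝ) → ℝ) : Prop :=
  ∀ t c s, R (Function.update t (Sum.inr (v, c)) s) = R t

/-- The function attached to the sphere glued from the trinions of `S` along the circles of `C`. -/
def partialSeries (S : Finset (Fin 4)) (C : Finset (Fin 3)) (t : TrinionEdge L → ℝ) : ℝ :=
  sphereSeries S.card ((D v).openSides S C) fun p => t (trinionSide D v p.1 p.2)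

lemma bddMeas_partialSeries {S : Finset (Fin 4)} (hS : 2 ≤ S.card) (C : Finset (Fin 3)) :
    BddMeas (partialSeries D v S C) :=
  (bddMeas_sphereSeries hS _).comp (measurable_pi_lambda _ fun _ => measurable_pi_apply _)

/-- After integration over the circles of `C`, the trinions of `S` contribute the factor `Φ`. -/
def Contracts (S : Finset (Fin 4)) (C : Finset (Fin 3)) (Φ : (TrinionEdge L → ℝ) → ℝ) : Prop :=
  (∀ c ∈ C, ∀ q : Fin 4 × Fin 3, (D v).side q.1 q.2 = Sum.inr c → q.1 ∈ S) ∧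
  S.card = C.card + 1 ∧
  ∀ R : (TrinionEdge L → ℝ) → ℝ, BddMeas R → IndepInner v R →
    ∫ t, (∏ a, sideInd D v a t) * R t ∂cubeMeasure _ =
      ∫ t, Φ t * ((∏ a ∈ Sᶜ, sideInd D v a t) * R t) ∂cubeMeasure _

variable {D v}

/-- The inductive step: only `Φ` and the new trinion can depend on the circle `c`, so averaging over
`c` acts on their product alone, where `havg` evaluates it. Leaving `Φ` general covers both a single
indicator and a series. -/
lemma Contracts.insert_trinion {S : Finset (Fin 4)} {C : Finset (Fin 3)} {Φ : (TrinionEdge L → ℝ) → ℝ}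
    (h : Contracts D v S C Φ) (hΦ : BddMeas Φ) {a : Fin 4} {j : Fin 3} {p : Fin 4 × Fin 3}
    {c : Fin 3} (hj : (D v).Joins S a j p c)
    (havg : ∀ t : TrinionEdge L → ℝ, (∀ e, t e ∈ Set.Icc (0 : ℝ) 1) →
      ∫ s, Φ (Function.update t (Sum.inr (v, c)) s) *
          sideInd D v a (Function.update t (Sum.inr (v, c)) s) ∂unitMeasure =
        ∑' n, trinionCoeff n ^ (S.card + 1) *
          ((∏ q ∈ ((D v).openSides S C).erase p, uVec n (t (trinionSide D v q.1 q.2))) *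
            ∏ k ∈ univ.erase j, uVec n (t (trinionSide D v a k)))) :
    Contracts D v (insert a S) (insert c C) (partialSeries D v (insert a S) (insert c C)) := by
  obtain ⟨hC, hcard, hint⟩ := h
  refine ⟨fun c' hc' q hq => ?_, ?_, fun R hR hRi => ?_⟩
  · rcases mem_insert.1 hc' with rfl | hc'
    · rcases hj.eq_or q hq with rfl | rfl
      · exact mem_insert_of_mem hj.mem
      · exact mem_insert_self _ _
    · exact mem_insert_of_mem (hC c' hc' q hq)
  · have hcC : c ∉ C := fun hc => hj.notMem (hC c hc (a, j) hj.side_new)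
    rw [card_insert_of_notMem hj.notMem, card_insert_of_notMem hcC, hcard]
  · rw [hint R hR hRi]
    set G : (TrinionEdge L → ℝ) → ℝ :=
      fun t => (∏ b ∈ (insert a S)ᶜ, sideInd D v b t) * R t with hG
    have hGb : BddMeas G := (BddMeas.prod _ fun b _ => bddMeas_sideInd D v b).mul hR
    have hGi (t : TrinionEdge L → ℝ) (s : ℝ) : G (Function.update t (Sum.inr (v, c)) s) = G t := by
      simp only [hG]
      rw [hRi t c s]
      congr 1
      refine prod_congr rfl fun b hb => ?_
      unfold sideInd
      congr 1
      ext k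
      refine Function.update_of_ne (fun hk => ?_) _ _
      rw [trinionSide_eq_inr_iff] at hk
      rw [mem_compl, mem_insert, not_or] at hb
      rcases hj.eq_or (b, k) hk with h1 | h1
      · exact hb.2 (by have := hj.mem; rwa [← h1] at this)
      · exact hb.1 (Prod.ext_iff.1 h1).1
    have hsplit (t : TrinionEdge L → ℝ) : Φ t * ((∏ b ∈ Sᶜ, sideInd D v b t) * R t) =
        (Φ t * sideInd D v a t) * G t := by
      rw [hG, ← mul_prod_erase Sᶜ _ (mem_compl.2 hj.notMem), ← compl_insert]
      ring
    simp_rw [hsplit]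
    rw [integral_update (Sum.inr (v, c)) (((hΦ.mul (bddMeas_sideInd D v a)).mul hGb).integrable _)]
    refine integral_congr_ae ?_
    filter_upwards [ae_mem_cube (TrinionEdge L)] with t ht
    simp_rw [hGi, integral_mul_const]
    rw [havg t ht]
    congr 1
    unfold partialSeries sphereSeries
    rw [card_insert_of_notMem hj.notMem]
    refine tsum_congr fun n => ?_
    rw [(D v).prod_openSides_insert hj hC]

lemma joins_side_ne {S : Finset (Fin 4)} {a : Fin 4} {j : Fin 3} {p : Fin 4 × Fin 3} {c : Fin 3}
    (h : (D v).Joins S a j p c) {q : Fin 4 × Fin 3} (h1 : q ≠ p) (h2 : q ≠ (a, j)) :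
    trinionSide D v q.1 q.2 ≠ Sum.inr (v, c) := fun hq => by
  rw [trinionSide_eq_inr_iff] at hq
  exact (h.eq_or q hq).elim h1 h2

/-- The induction starts from two trinions: a single one is kept as an indicator, because its series
is not absolutely convergent, and Parseval's identity performs the first gluing. -/
lemma contracts_two (D : DualVertex L → SixHolePants) (v : DualVertex L) :
    ∃ S C, S.card = 2 ∧ Contracts D v S C (partialSeries D v S C) := by
  obtain ⟨a, j, p, c, hj⟩ := (D v).exists_joins (S := {0}) (singleton_nonempty 0) (by decide)
  have h0 : Contracts D v {0} ∅ (sideInd D v 0) := by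
    refine ⟨by simp, by simp, fun R _ _ => ?_⟩
    refine integral_congr_ae (Filter.Eventually.of_forall fun t => ?_)
    simp only
    rw [← mul_prod_erase univ _ (mem_univ (0 : Fin 4)), mul_assoc, compl_singleton]
  have ha : a ≠ 0 := by simpa using hj.notMem
  obtain ⟨p1, p2⟩ := p
  obtain rfl : p1 = 0 := by simpa using hj.mem
  refine ⟨insert a {0}, insert c ∅, by rw [card_pair ha],
    h0.insert_trinion (bddMeas_sideInd D v 0) hj fun t ht => ?_⟩
  unfold sideInd
  rw [integral_trinionInd_mul ht ((trinionSide_eq_inr_iff D v).2 hj.side_old) (fun k hk => ?_)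
    ((trinionSide_eq_inr_iff D v).2 hj.side_new) (fun k hk => ?_)]
  · refine tsum_congr fun n => ?_
    congr 2
    symm
    refine prod_bij (fun q _ => q.2) ?_ ?_ ?_ ?_
    · rintro ⟨q1, q2⟩ hq
      simp only [SixHolePants.openSides, mem_erase, mem_filter, mem_singleton] at hq
      obtain rfl := hq.2.2.1
      simpa using hq.1
    · rintro ⟨q1, q2⟩ hq ⟨r1, r2⟩ hr h
      simp only [SixHolePants.openSides, mem_erase, mem_filter, mem_singleton] at hq hr h
      rw [hq.2.2.1, hr.2.2.1, h]
    · intro k hk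
      refine ⟨(0, k), ?_, rfl⟩
      simp only [SixHolePants.openSides, mem_erase, mem_filter]
      simpa using hk
    · rintro ⟨q1, q2⟩ hq
      simp only [SixHolePants.openSides, mem_erase, mem_filter, mem_singleton] at hq
      obtain rfl := hq.2.2.1
      rfl
  · exact joins_side_ne hj (q := (0, k)) (by simpa using hk) (by simp [ha.symm])
  · exact joins_side_ne hj (q := (a, k)) (by simp [ha]) (by simpa using hk)

lemma Contracts.extend {S : Finset (Fin 4)} {C : Finset (Fin 3)} (hS : 2 ≤ S.card)
    (h : Contracts D v S C (partialSeries D v S C)) (hS' : S ≠ univ) :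
    ∃ S' C', S'.card = S.card + 1 ∧ Contracts D v S' C' (partialSeries D v S' C') := by
  obtain ⟨a, j, p, c, hj⟩ := (D v).exists_joins (card_pos.1 (by omega)) hS'
  have hp : p ∈ (D v).openSides S C := by
    refine mem_filter.2 ⟨mem_univ _, hj.mem, fun c' hc' hs => ?_⟩
    rw [hj.side_old] at hs
    obtain rfl := Sum.inr_injective hs
    exact hj.notMem (h.1 c hc' (a, j) hj.side_new)
  have hQ : ∀ q ∈ (D v).openSides S C, q ≠ p → trinionSide D v q.1 q.2 ≠ Sum.inr (v, c) := by
    refine fun q hq hqp => joins_side_ne hj hqp fun hq' => hj.notMem ?_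
    rw [hq'] at hq
    exact (mem_filter.1 hq).2.1
  have hb : ∀ k ≠ j, trinionSide D v a k ≠ Sum.inr (v, c) := by
    refine fun k hk => joins_side_ne hj (q := (a, k)) (fun hp => hj.notMem ?_) (by simpa using hk)
    have := hj.mem
    rwa [← hp] at this
  refine ⟨insert a S, insert c C, card_insert_of_notMem hj.notMem,
    h.insert_trinion (bddMeas_partialSeries D v hS C) hj fun t ht => ?_⟩
  unfold partialSeries sideInd
  rw [integral_sphereSeries_mul_trinionInd (f := fun p => trinionSide D v p.1 p.2)
    (b := trinionSide D v a) (z := Sum.inr (v, c)) ht hS hp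
    ((trinionSide_eq_inr_iff D v).2 hj.side_old) hQ
    ((trinionSide_eq_inr_iff D v).2 hj.side_new) hb]

variable (D v)

/-- The function of the plaquettes around `v` that is the volume of the space of inner circles. -/
def vertexSeries (v : DualVertex L) (t : TrinionEdge L → ℝ) : ℝ :=
  sphereSeries 4 univ fun h : Face => t (Sum.inl (facePlaquette v h))

/-- Integrating out the inner circles over a vertex. -/
lemma integral_prod_sideInd {R : (TrinionEdge L → ℝ) → ℝ} (hR : BddMeas R)
    (hRi : IndepInner v R) :
    ∫ t, (∏ a, sideInd D v a t) * R t ∂cubeMeasure _ =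
      ∫ t, vertexSeries v t * R t ∂cubeMeasure _ := by
  have hall : ∀ m ≤ 2, ∃ S C, S.card = 2 + m ∧ Contracts D v S C (partialSeries D v S C) := by
    intro m
    induction m with
    | zero => exact fun _ => contracts_two D v
    | succ m ih =>
      intro hm
      obtain ⟨S, C, hS, h⟩ := ih (by omega)
      obtain ⟨S', C', hS', h'⟩ := h.extend (by omega) (fun hu => by simp [hu] at hS; omega)
      exact ⟨S', C', by omega, h'⟩
  obtain ⟨S, C, hS, hC, hcard, h⟩ := hall 2 le_rfl
  obtain rfl : S = univ := by rw [← card_eq_iff_eq_univ]; simpa using hS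
  -- Each gluing uses one circle, so four trinions have used up all three.
  obtain rfl : C = univ := by
    rw [← card_eq_iff_eq_univ]
    simp at hcard ⊢
    omega
  rw [h R hR hRi]
  refine integral_congr_ae (Filter.Eventually.of_forall fun t => ?_)
  simp only [compl_univ, prod_empty, one_mul]
  congr 1
  unfold partialSeries vertexSeries sphereSeries
  refine tsum_congr fun n => ?_
  rw [← (D v).prod_openSides_univ _ fun c => uVec n (t (Sum.inr (v, c)))]
  congr 1
  refine prod_congr rfl fun q _ => ?_
  simp only [trinionSide]
  rcases (D v).side q.1 q.2 with h | c <;> rfl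

end SymplecticLattice

end

/-! ### Products of series over the vertices, and termwise integration over the plaquettes. -/

noncomputable section

namespace SymplecticLattice

open Finset MeasureTheory

lemma hasSum_prod_option {α : Type*} [Fintype α] (g : Option α → ℕ → ℝ)
    (h0 : Summable fun n => ‖g none n‖)
    (h1 : Summable fun n : α → ℕ => ‖∏ a, g (some a) (n a)‖)
    (h2 : HasSum (fun n : α → ℕ => ∏ a, g (some a) (n a)) (∏ a, ∑' k, g (some a) k)) :
    (Summable fun n : Option α → ℕ => ‖∏ i, g i (n i)‖) ∧
      HasSum (fun n : Option α → ℕ => ∏ i, g i (n i)) (∏ i, ∑' k, g i k) := by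
  let e : ℕ × (α → ℕ) ≃ (Option α → ℕ) :=
    (Equiv.piOptionEquivProd (β := fun _ : Option α => ℕ)).symm
  have key (n : ℕ × (α → ℕ)) :
      ∏ i, g i (e n i) = g none n.1 * ∏ a, g (some a) (n.2 a) := by
    rw [Fintype.prod_option]
    rfl
  rw [Fintype.prod_option, ← e.summable_iff, ← e.hasSum_iff]
  simp only [Function.comp_def, key]
  refine ⟨Summable.mul_norm (f := g none) (g := fun n : α → ℕ => ∏ a, g (some a) (n a)) h0 h1, ?_⟩
  rw [← h2.tsum_eq, tsum_mul_tsum_of_summable_norm h0 h1]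
  exact (summable_mul_of_summable_norm (f := g none)
    (g := fun n : α → ℕ => ∏ a, g (some a) (n a)) h0 h1).hasSum

lemma hasSum_prod_equiv {α β : Type*} [Fintype α] [Fintype β] (e : α ≃ β) (g : β → ℕ → ℝ)
    (h1 : Summable fun n : α → ℕ => ‖∏ a, g (e a) (n a)‖)
    (h2 : HasSum (fun n : α → ℕ => ∏ a, g (e a) (n a)) (∏ a, ∑' k, g (e a) k)) :
    (Summable fun n : β → ℕ => ‖∏ i, g i (n i)‖) ∧
      HasSum (fun n : β → ℕ => ∏ i, g i (n i)) (∏ i, ∑' k, g i k) := by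
  have key (n : α → ℕ) : ∏ b, g b (e.arrowCongr (Equiv.refl ℕ) n b) = ∏ a, g (e a) (n a) := by
    rw [← e.prod_comp]
    simp
  rw [← e.prod_comp, ← (e.arrowCongr (Equiv.refl ℕ)).summable_iff,
    ← (e.arrowCongr (Equiv.refl ℕ)).hasSum_iff]
  simp only [Function.comp_def, key]
  exact ⟨h1, h2⟩

lemma hasSum_prod_fin (m : ℕ) (g : Fin m → ℕ → ℝ) (hg : ∀ i, Summable fun n => ‖g i n‖) :
    (Summable fun n : Fin m → ℕ => ‖∏ i, g i (n i)‖) ∧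
      HasSum (fun n : Fin m → ℕ => ∏ i, g i (n i)) (∏ i, ∑' k, g i k) := by
  induction m with
  | zero =>
    simp only [univ_eq_empty, prod_empty]
    exact ⟨(hasSum_unique _).summable, hasSum_unique (fun _ : Fin 0 → ℕ => (1 : ℝ))⟩
  | succ m ih =>
    let e := (finSuccEquiv m).symm
    obtain ⟨h1, h2⟩ := ih (fun a => g (e (some a))) fun a => hg (e (some a))
    obtain ⟨h3, h4⟩ := hasSum_prod_option (fun a => g (e a)) (hg (e none)) h1 h2
    exact hasSum_prod_equiv e g h3 h4

/-- A finite product of absolutely convergent series. -/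
lemma hasSum_prod_pi {ι : Type*} [Fintype ι] (g : ι → ℕ → ℝ) (hg : ∀ i, Summable fun n => ‖g i n‖) :
    (Summable fun n : ι → ℕ => ‖∏ i, g i (n i)‖) ∧
      HasSum (fun n : ι → ℕ => ∏ i, g i (n i)) (∏ i, ∑' k, g i k) := by
  let e := (Fintype.equivFin ι).symm
  obtain ⟨h1, h2⟩ := hasSum_prod_fin _ (fun a => g (e a)) fun a => hg (e a)
  exact hasSum_prod_equiv e g h1 h2

variable {L : ℕ} [NeZero L] (D : DualVertex L → SixHolePants) (β : ℝ)

lemma bddMeas_wilsonWeight : BddMeas (wilsonWeight L β) := by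
  refine ⟨?_, Real.exp (4 / β ^ 2 * ∑ _e : Plaquette L, 1), fun t => ?_⟩
  · have : Continuous (wilsonWeight L β) := by unfold wilsonWeight; fun_prop
    exact this.measurable
  · rw [wilsonWeight, Real.abs_exp]
    gcongr
    exact Real.cos_le_one _

lemma mem_cube_of_mem_latticePolytope {t : TrinionEdge L → ℝ} (ht : t ∈ latticePolytope D)
    (e : TrinionEdge L) : t e ∈ Set.Icc (0 : ℝ) 1 := by
  rcases e with ⟨v, i⟩ | ⟨v, c⟩
  · obtain ⟨p, hp, -⟩ := (D v).hole_once (i, true)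
    have h := (ht v p.1).1 p.2
    simp only [trinionSide, hp] at h
    exact h
  · have hne : {p : Fin 4 × Fin 3 | (D v).side p.1 p.2 = Sum.inr c}.Nonempty :=
      Set.nonempty_of_ncard_ne_zero (by rw [(D v).inner_twice]; decide)
    obtain ⟨p, hp⟩ := hne
    have h : t (trinionSide D v p.1 p.2) ∈ Set.Icc (0 : ℝ) 1 := (ht v p.1).1 p.2
    rwa [(trinionSide_eq_inr_iff D v).2 hp] at h

lemma indicator_latticePolytope (t : TrinionEdge L → ℝ) :
    (latticePolytope D).indicator 1 t = ∏ v, ∏ a, sideInd D v a t := by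
  by_cases h : t ∈ latticePolytope D
  · rw [Set.indicator_of_mem h]
    symm
    exact prod_eq_one fun v _ => prod_eq_one fun a _ => Set.indicator_of_mem (h v a) _
  · rw [Set.indicator_of_notMem h]
    obtain ⟨v, a, hva⟩ : ∃ v a, (fun j => t (trinionSide D v a j)) ∉ trinionPolytope := by
      by_contra! hc
      exact h hc
    rw [eq_comm]
    exact prod_eq_zero (mem_univ v)
      (prod_eq_zero (mem_univ a) (Set.indicator_of_notMem hva _))

lemma measurableSet_latticePolytope : MeasurableSet (latticePolytope D) := by
  have : latticePolytope D =
      ⋂ v, ⋂ a, (fun t j => t (trinionSide D v a j)) ⁻¹' trinionPolytope := by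
    ext t
    simp only [Set.mem_iInter, Set.mem_preimage]
    rfl
  rw [this]
  exact MeasurableSet.iInter fun v => MeasurableSet.iInter fun a =>
    measurableSet_trinionPolytope.preimage (measurable_pi_lambda _ fun _ => measurable_pi_apply _)

lemma latticePolytope_subset :
    latticePolytope D ⊆ Set.univ.pi fun _ : TrinionEdge L => Set.Icc (0 : ℝ) 1 :=
  fun _ ht e _ => mem_cube_of_mem_latticePolytope D ht e

lemma integrableOn_wilsonWeight : IntegrableOn (wilsonWeight L β) (latticePolytope D) := by
  have h := (bddMeas_wilsonWeight (L := L) β).integrable (cubeMeasure _)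
  rw [cubeMeasure_eq_restrict] at h
  exact IntegrableOn.mono_set h (latticePolytope_subset D)

lemma partitionFunction_eq_integral_cube : partitionFunction D β =
    ∫ t, (∏ v, ∏ a, sideInd D v a t) * wilsonWeight L β t ∂cubeMeasure _ := by
  simp_rw [← indicator_latticePolytope]
  have h (t : TrinionEdge L → ℝ) : (latticePolytope D).indicator 1 t * wilsonWeight L β t =
      (latticePolytope D).indicator (wilsonWeight L β) t := by
    by_cases h : t ∈ latticePolytope D <;> simp [h]
  simp_rw [h]
  rw [cubeMeasure_eq_restrict, setIntegral_indicator (measurableSet_latticePolytope D),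
    Set.inter_eq_right.2 (latticePolytope_subset D), partitionFunction]

lemma bddMeas_vertexSeries (v : DualVertex L) : BddMeas (vertexSeries v) :=
  (bddMeas_sphereSeries (by norm_num) _).comp
    (measurable_pi_lambda _ fun _ => measurable_pi_apply _)

/-- All the inner circles can be integrated out, vertex by vertex. -/
lemma partitionFunction_eq_integral_vertexSeries : partitionFunction D β =
    ∫ t, (∏ v, vertexSeries v t) * wilsonWeight L β t ∂cubeMeasure _ := by
  -- `T` is the set of vertices whose inner circles have already been integrated out.
  have key (T : Finset (DualVertex L)) : partitionFunction D β =
      ∫ t, ((∏ v ∈ T, vertexSeries v t) * (∏ v ∈ Tᶜ, ∏ a, sideInd D v a t)) *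
        wilsonWeight L β t ∂cubeMeasure _ := by
    induction T using Finset.induction_on with
    | empty => simpa using partitionFunction_eq_integral_cube D β
    | insert v T hv ih =>
      set R : (TrinionEdge L → ℝ) → ℝ := fun t => ((∏ v ∈ T, vertexSeries v t) *
        (∏ v ∈ (insert v T)ᶜ, ∏ a, sideInd D v a t)) * wilsonWeight L β t with hR
      have hRb : BddMeas R :=
        ((BddMeas.prod _ fun v _ => bddMeas_vertexSeries v).mul (BddMeas.prod _ fun v _ =>
          BddMeas.prod _ fun a _ => bddMeas_sideInd D v a)).mul (bddMeas_wilsonWeight β)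
      -- The vertex series and the weight see only plaquettes, and the remaining trinions lie over
      -- vertices other than `v`.
      have hRi : IndepInner v R := by
        intro t c s
        have h1 (e : Plaquette L) : Function.update t (Sum.inr (v, c)) s (Sum.inl e) =
            t (Sum.inl e) := Function.update_of_ne (by simp) _ _
        have hw1 : ∀ w, vertexSeries w (Function.update t (Sum.inr (v, c)) s) =
            vertexSeries w t := fun w => by
          unfold vertexSeries
          simp_rw [h1]
        have hw2 : wilsonWeight L β (Function.update t (Sum.inr (v, c)) s) =
            wilsonWeight L β t := by
          unfold wilsonWeight
          simp_rw [h1]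
        have hw3 : ∏ w ∈ (insert v T)ᶜ, ∏ a,
            sideInd D w a (Function.update t (Sum.inr (v, c)) s) =
            ∏ w ∈ (insert v T)ᶜ, ∏ a, sideInd D w a t := by
            refine prod_congr rfl fun w hw => prod_congr rfl fun a _ => ?_
            unfold sideInd
            congr 1
            ext j
            refine Function.update_of_ne (fun hj => ?_) _ _
            have hwv : w = v := by
              unfold trinionSide at hj
              rcases hs : (D w).side a j with h | c'
              · simp [hs] at hj
              · simp only [hs, Sum.map_inr, Sum.inr.injEq, Prod.mk.injEq] at hj
                exact hj.1
            rw [mem_compl, hwv] at hw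
            exact hw (mem_insert_self v T)
        simp only [hR]
        rw [hw2, hw3, prod_congr rfl fun w _ => hw1 w]
      have h := integral_prod_sideInd D v hRb hRi
      rw [ih]
      refine Eq.trans (integral_congr_ae (Filter.Eventually.of_forall fun t => ?_))
        (h.trans (integral_congr_ae (Filter.Eventually.of_forall fun t => ?_)))
      · simp only [hR]
        rw [← mul_prod_erase Tᶜ _ (mem_compl.2 hv), ← compl_insert]
        ring
      · simp only [hR]
        rw [prod_insert hv, ← mul_assoc, ← mul_assoc]
  simpa using key univ

lemma prod_faces (n : DualVertex L → ℕ) (t : TrinionEdge L → ℝ) :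
    ∏ v, ∏ h : Face, uVec (n v) (t (Sum.inl (facePlaquette v h))) =
      ∏ e : Plaquette L, uVec (n e.1) (t (Sum.inl e)) * uVec (n (e.1.next e.2)) (t (Sum.inl e)) := by
  simp_rw [Fintype.prod_prod_type, Fintype.prod_bool, facePlaquette, prod_mul_distrib]
  congr 1
  rw [prod_comm, prod_comm (s := univ (α := DualVertex L))]
  refine prod_congr rfl fun i _ => ?_
  -- The plaquette `(v, i)` is the negative face of `v + e_i`, so a translation matches the negative
  -- faces with the far ends of edges.
  rw [← Equiv.prod_comp (Equiv.addRight (Pi.single i 1 : DualVertex L))]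
  refine prod_congr rfl fun v _ => ?_
  simp [DualVertex.next, DualVertex.prev]

lemma wilsonWeight_eq_prod (t : TrinionEdge L → ℝ) : wilsonWeight L β t =
    ∏ e : Plaquette L, Real.exp (2 * (2 / β ^ 2) * Real.cos (Real.pi * t (Sum.inl e))) := by
  rw [wilsonWeight, mul_sum, Real.exp_sum]
  refine prod_congr rfl fun e _ => ?_
  ring_nf

lemma integral_cube_vertexTerm (n : DualVertex L → ℕ) :
    ∫ t, (∏ v, trinionCoeff (n v) ^ 4 *
        ∏ h : Face, uVec (n v) (t (Sum.inl (facePlaquette v h)))) *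
        wilsonWeight L β t ∂cubeMeasure (TrinionEdge L) =
      vertexTerm (edgeIntegral β) n := by
  let φ : Plaquette L → ℝ → ℝ := fun e x => uVec (n e.1) x * uVec (n (e.1.next e.2)) x *
    Real.exp (2 * (2 / β ^ 2) * Real.cos (Real.pi * x))
  -- Inner circles enter with the constant factor one. The integrand becomes a product over all
  -- coordinates, and the product measure factorizes its integral.
  have h1 (t : TrinionEdge L → ℝ) : (∏ v, trinionCoeff (n v) ^ 4 *
        ∏ h : Face, uVec (n v) (t (Sum.inl (facePlaquette v h)))) * wilsonWeight L β t =
      (∏ v, trinionCoeff (n v) ^ 4) *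
        ∏ x : TrinionEdge L, (Sum.elim φ (fun _ _ => 1) x : ℝ → ℝ) (t x) := by
    rw [prod_mul_distrib, prod_faces, wilsonWeight_eq_prod, mul_assoc, ← prod_mul_distrib,
      Fintype.prod_sum_type]
    simp [φ]
  simp_rw [h1]
  rw [integral_const_mul, cubeMeasure, integral_fintype_prod_eq_prod, Fintype.prod_sum_type]
  simp only [Sum.elim_inl, Sum.elim_inr, integral_const, probReal_univ, smul_eq_mul, mul_one,
    prod_const_one]
  unfold vertexTerm trinionCoeff
  congr 1
  refine prod_congr rfl fun e _ => ?_
  rw [edgeIntegral, intervalIntegral.integral_of_le zero_le_one, ← integral_Icc_eq_integral_Ioc]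
  rfl

lemma hasSum_vertexTerm :
    HasSum (fun n : DualVertex L → ℕ => vertexTerm (edgeIntegral β) n) (partitionFunction D β) := by
  rw [partitionFunction_eq_integral_vertexSeries]
  have hprod (t : TrinionEdge L → ℝ) := hasSum_prod_pi
    (fun (v : DualVertex L) k => trinionCoeff k ^ 4 *
      ∏ h : Face, uVec k (t (Sum.inl (facePlaquette v h))))
    (fun v => (summable_sphereSeries (by norm_num) univ
      fun h : Face => t (Sum.inl (facePlaquette v h))).norm)
  -- A majorant uniform in `t`, from `|uVec n| ≤ 2` on the six faces; it justifies exchanging the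
  -- sum over labellings with the integral.
  have hbound := (hasSum_prod_pi
    (fun (_ : DualVertex L) k => trinionCoeff k ^ 4 * 2 ^ (univ : Finset Face).card)
    (fun v => ((summable_trinionCoeff_pow (by norm_num)).mul_right _).norm)).2.summable
  obtain ⟨hWm, B, hB⟩ := bddMeas_wilsonWeight (L := L) β
  have hterm (n : DualVertex L → ℕ) (t : TrinionEdge L → ℝ) :
      ‖(∏ v, trinionCoeff (n v) ^ 4 *
        ∏ h : Face, uVec (n v) (t (Sum.inl (facePlaquette v h)))) * wilsonWeight L β t‖ ≤
      (∏ v, trinionCoeff (n v) ^ 4 * 2 ^ (univ : Finset Face).card) * B := by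
    rw [norm_mul, norm_prod]
    refine mul_le_mul (prod_le_prod (fun _ _ => norm_nonneg _) fun v _ =>
      norm_sphereSeries_term_le 4 univ (fun h : Face => t (Sum.inl (facePlaquette v h))) (n v))
      (hB t) (norm_nonneg _) (prod_nonneg fun v _ => ?_)
    have := trinionCoeff_nonneg (n v)
    positivity
  have hint (n : DualVertex L → ℕ) : Integrable (fun t : TrinionEdge L → ℝ =>
      (∏ v, trinionCoeff (n v) ^ 4 *
        ∏ h : Face, uVec (n v) (t (Sum.inl (facePlaquette v h)))) * wilsonWeight L β t)
      (cubeMeasure _) := by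
    refine BddMeas.integrable ⟨Measurable.mul ?_ hWm, _, hterm n⟩ _
    refine Continuous.measurable (continuous_finsetProd _ fun v _ => continuous_const.mul
      (continuous_finsetProd _ fun h _ => (continuous_uVec (n v)).comp (continuous_apply _)))
  have h := hasSum_integral_of_summable_integral_norm hint (Summable.of_nonneg_of_le
    (fun n => integral_nonneg fun t => norm_nonneg _) (fun n => ?_) (hbound.mul_right B))
  · simp_rw [integral_cube_vertexTerm, tsum_mul_right, (hprod _).2.tsum_eq] at h
    exact h
  · calc _ ≤ ∫ _t, (∏ v, trinionCoeff (n v) ^ 4 * 2 ^ (univ : Finset Face).card) * B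
          ∂cubeMeasure (TrinionEdge L) :=
          integral_mono (hint n).norm (integrable_const _) (hterm n)
      _ = _ := by simp

end SymplecticLattice

end

theorem mainTheorem5 (L : ℕ) [NeZero L]
    (D : SymplecticLattice.DualVertex L → SymplecticLattice.SixHolePants)
    (β : ℝ) (hβ : 0 < β) :
    -- the integrand of the partition function is integrable
    MeasureTheory.IntegrableOn (SymplecticLattice.wilsonWeight L β)
      (SymplecticLattice.latticePolytope D) ∧
    -- the numbers `charMult p k` are multiplicities in powers of the fundamental character
    (∀ (p : ℕ) (u : ℝ), Real.sin u ≠ 0 →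
      SymplecticLattice.su2Char 1 u ^ p = ∑ k ∈ Finset.range (p / 2 + 1),
        (SymplecticLattice.charMult p k : ℝ) * SymplecticLattice.su2Char (p - 2 * k) u) ∧
    (∀ p k : ℕ, 2 * k ≤ p → 0 < SymplecticLattice.charMult p k) ∧
    -- the contribution of an edge
    (∀ l : ℕ, Summable (SymplecticLattice.edgeTerm β l)) ∧
    (∀ n m : ℕ, SymplecticLattice.edgeIntegral β n m = SymplecticLattice.edgeFactor β n m) ∧
    -- the partition function as a series over vertex labels, with edge integrals
    HasSum (fun n : SymplecticLattice.DualVertex L → ℕ =>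
        SymplecticLattice.vertexTerm (SymplecticLattice.edgeIntegral β) n)
      (SymplecticLattice.partitionFunction D β) ∧
    -- the partition function as a series of positive terms over vertex labels
    (∀ n : SymplecticLattice.DualVertex L → ℕ,
      0 < SymplecticLattice.vertexTerm (SymplecticLattice.edgeFactor β) n) ∧
    HasSum (fun n : SymplecticLattice.DualVertex L → ℕ =>
        SymplecticLattice.vertexTerm (SymplecticLattice.edgeFactor β) n)
      (SymplecticLattice.partitionFunction D β) := by
  have hF : SymplecticLattice.edgeIntegral β = SymplecticLattice.edgeFactor β :=
    funext₂ (SymplecticLattice.edgeIntegral_eq_edgeFactor β)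
  have hZ := SymplecticLattice.hasSum_vertexTerm D β
  exact ⟨SymplecticLattice.integrableOn_wilsonWeight D β,
    fun p _ hu => SymplecticLattice.su2Char_one_pow p hu,
    fun _ _ => SymplecticLattice.charMult_pos,
    fun l => (SymplecticLattice.hasSum_edgeTerm β l).summable,
    SymplecticLattice.edgeIntegral_eq_edgeFactor β, hZ,
    SymplecticLattice.vertexTerm_pos (SymplecticLattice.edgeFactor_pos hβ), hF ▸ hZ⟩
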